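/- Let $k$ be a field of characteristic zero, $n \ge 0$, $R = k[x_1,\dots,x_n]$ with its standard grading, and $\widehat R = k[[x_1,\dots,x_n]]$. Let $\mathscr D = \mathscr D(R,k)$ and $\widehat{\mathscr D} = \mathscr D(\widehat R,k)$ be the rings of $k$-linear differential operators on $R$ and on $\widehat R$, with $\mathscr D \subseteq \widehat{\mathscr D}$ the inclusion extending $R \subseteq \widehat R$ and sending $\partial_i$ to $\partial_i$. Let $R^\tau$ be the right $\mathscr D$-module with underlying group $R$ and action $r\cdot\delta = \tau(\delta)(r)$, where $\tau$ is the standard transposition $\tau(f\,\partial_1^{i_1}\cdots\partial_n^{i_n}) = (-1)^{i_1+\cdots+i_n}\,\partial_1^{i_1}\cdots\partial_n^{i_n} f$; define the right $\widehat{\mathscr D}$-module $\widehat R^\tau$ in the same way. For a left $\mathscr D$-module $M$, let $\widehat M = \widehat R\otimes_R M$, which is a left $\widehat{\mathscr D}$-module in which $\widehat R$ acts by multiplication on the first factor and $\partial_i(\widehat s\otimes m) = \partial_i(\widehat s)\otimes m + \widehat s\otimes \partial_i m$. Let $M$ be a finitely generated graded left $\mathscr D$-module, that is, a finitely generated left $\mathscr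 D$-module with a decomposition $M=\bigoplus_{l\in\mathbb Z} M_l$ such that $R_d\, M_l\subseteq M_{d+l}$ for all $d \ge 0$ and $l \in \mathbb Z$, and $\partial_i M_l\subseteq M_{l-1}$ for all $i$ and $l$. For $j\ge 0$ let $$\iota_j:\ \mathrm{Tor}_j^{\mathscr D}(R^\tau,M)\longrightarrow \mathrm{Tor}_j^{\widehat{\mathscr D}}(\widehat R^\tau,\widehat M)$$ be the natural $k$-linear map induced by $\mathscr D\subseteq\widehat{\mathscr D}$, $R^\tau\subseteq\widehat R^\tau$ and $M\to\widehat M$, $m\mapsto 1\otimes m$: it is the map on homology of $R^\tau\otimes_{\mathscr D}P_\bullet\to\widehat R^\tau\otimes_{\widehat{\mathscr D}}Q_\bullet$ obtained from projective resolutions $P_\bullet\to M$ over $\mathscr D$ and $Q_\bullet\to\widehat M$ over $\widehat{\mathscr D}$ and a $\mathscr D$-linear chain map $P_\bullet\to Q_\bullet$ lifting $M\to\widehat M$. Then: (a) $\iota_j$ is injective for every $j\ge 0$. (b) For every $j\ge 0$ such that $\dim_k \mathrm{Tor}_j^{\mathscr D}(R^\tau,M)<\infty$, the map $\iota_j$ is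 an isomorphism of $k$-vector spaces. -/

import Mathlib

universe u

namespace DMod

noncomputable section

open scoped TensorProduct


section DiffOp

variable (k : Type u) (A : Type u) [CommRing k] [CommRing A] [Algebra k A]

/-- `IsDiffOp k A m P`: the `k`-linear endomorphism `P` of `A` is a differential operator of
order at most `m` in the sense of Grothendieck. -/
def IsDiffOp : ℕ → Module.End k A → Prop
  | 0, P => ∀ a : A, P * Algebra.lmul k A a - Algebra.lmul k A a * P = 0
  | m + 1, P => ∀ a : A, IsDiffOp m (P * Algebra.lmul k A a - Algebra.lmul k A a * P)

variable {k A}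

lemma IsDiffOp.zero_op (m : ℕ) : IsDiffOp k A m 0 := by
  induction m with
  | zero => intro a; simp
  | succ m ih => intro a; simpa using ih

lemma IsDiffOp.succ {m : ℕ} {P : Module.End k A} (h : IsDiffOp k A m P) :
    IsDiffOp k A (m + 1) P := by
  induction m generalizing P with
  | zero => intro a; rw [h a]; exact IsDiffOp.zero_op 0
  | succ m ih => intro a; exact ih (h a)

lemma IsDiffOp.mono {m m' : ℕ} (hm : m ≤ m') {P : Module.End k A} (h : IsDiffOp k A m P) :
    IsDiffOp k A m' P := by
  induction hm with
  | refl => exact h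
  | step _ ih => exact ih.succ

lemma IsDiffOp.add {m : ℕ} {P Q : Module.End k A} (hP : IsDiffOp k A m P)
    (hQ : IsDiffOp k A m Q) : IsDiffOp k A m (P + Q) := by
  induction m generalizing P Q with
  | zero =>
    intro a
    have h := congrArg₂ (· + ·) (hP a) (hQ a)
    simp only [add_zero] at h
    rw [← h]; noncomm_ring
  | succ m ih =>
    intro a
    have h := ih (hP a) (hQ a)
    convert h using 1
    noncomm_ring

lemma IsDiffOp.lmul (a : A) : IsDiffOp k A 0 (Algebra.lmul k A a) := by
  intro b
  rw [← map_mul, ← map_mul, mul_comm, sub_self]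

lemma IsDiffOp.mul {m m' : ℕ} {P Q : Module.End k A} (hP : IsDiffOp k A m P)
    (hQ : IsDiffOp k A m' Q) : IsDiffOp k A (m + m') (P * Q) := by
  have key : ∀ (P Q : Module.End k A) (a : A),
      P * Q * Algebra.lmul k A a - Algebra.lmul k A a * (P * Q) =
      P * (Q * Algebra.lmul k A a - Algebra.lmul k A a * Q) +
      (P * Algebra.lmul k A a - Algebra.lmul k A a * P) * Q := by
    intro P Q a; simp only [mul_sub, sub_mul, mul_assoc]; abel
  induction hs : m + m' generalizing m m' P Q with
  | zero =>
    obtain ⟨rfl, rfl⟩ : m = 0 ∧ m' = 0 := by omega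
    intro a
    rw [key, hP a, hQ a]; simp
  | succ s ih =>
    intro a
    rw [key]
    refine IsDiffOp.add ?_ ?_
    · cases m' with
      | zero => rw [hQ a, mul_zero]; exact IsDiffOp.zero_op _
      | succ m' => exact ih hP (hQ a) (by omega)
    · cases m with
      | zero => rw [hP a, zero_mul]; exact IsDiffOp.zero_op _
      | succ m => exact ih (hP a) hQ (by omega)

variable (k A) in
/-- The subring of `End_k(A)` formed by the `k`-linear differential operators on `A`. -/
def diffOps : Subring (Module.End k A) where
  carrier := {P | ∃ m, IsDiffOp k A m P}
  mul_mem' := fun ⟨m, hm⟩ ⟨m', hm'⟩ => ⟨m + m', hm.mul hm'⟩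
  add_mem' := fun ⟨m, hm⟩ ⟨m', hm'⟩ =>
    ⟨max m m', (hm.mono (le_max_left _ _)).add (hm'.mono (le_max_right _ _))⟩
  zero_mem' := ⟨0, IsDiffOp.zero_op 0⟩
  one_mem' := ⟨0, by rw [← map_one (Algebra.lmul k A)]; exact IsDiffOp.lmul 1⟩
  neg_mem' := fun {P} ⟨m, hm⟩ => ⟨0 + m, by
    have h : -P = Algebra.lmul k A (-1) * P := by ext a; simp
    rw [h]; exact (IsDiffOp.lmul _).mul hm⟩

variable (k A) in
/-- The ring `𝒟(A, k)` of `k`-linear differential operators on `A`. -/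
def DiffOp : Type u := diffOps k A

instance : Ring (DiffOp k A) := inferInstanceAs (Ring (diffOps k A))

/-- A differential operator as a `k`-linear endomorphism of `A`. -/
def DiffOp.toEnd (P : DiffOp k A) : Module.End k A := P.1

lemma DiffOp.ext {P Q : DiffOp k A} (h : P.toEnd = Q.toEnd) : P = Q := Subtype.ext h

@[simp] lemma DiffOp.toEnd_zero : (0 : DiffOp k A).toEnd = 0 := rfl

@[simp] lemma DiffOp.toEnd_one : (1 : DiffOp k A).toEnd = 1 := rfl

@[simp] lemma DiffOp.toEnd_add (P Q : DiffOp k A) : (P + Q).toEnd = P.toEnd + Q.toEnd := rfl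

@[simp] lemma DiffOp.toEnd_neg (P : DiffOp k A) : (-P).toEnd = -P.toEnd := rfl

@[simp] lemma DiffOp.toEnd_sub (P Q : DiffOp k A) : (P - Q).toEnd = P.toEnd - Q.toEnd := rfl

@[simp] lemma DiffOp.toEnd_mul (P Q : DiffOp k A) : (P * Q).toEnd = P.toEnd * Q.toEnd := rfl

/-- `A` is a left `𝒟(A, k)`-module: operators act on functions. -/
instance : Module (DiffOp k A) A :=
  Module.compHom A
    ({ toFun := DiffOp.toEnd, map_zero' := rfl, map_one' := rfl, map_add' := fun _ _ => rfl,
       map_mul' := fun _ _ => rfl } : DiffOp k A →+* Module.End k A)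

lemma DiffOp.smul_def (P : DiffOp k A) (a : A) : P • a = P.toEnd a := rfl

/-- The operator of multiplication by an element of `A`. -/
def DiffOp.ofFun : A →+* DiffOp k A where
  toFun a := ⟨Algebra.lmul k A a, 0, IsDiffOp.lmul a⟩
  map_one' := DiffOp.ext (map_one (Algebra.lmul k A))
  map_mul' a b := DiffOp.ext (map_mul (Algebra.lmul k A) a b)
  map_zero' := DiffOp.ext (map_zero (Algebra.lmul k A))
  map_add' a b := DiffOp.ext (map_add (Algebra.lmul k A) a b)

/-- A `k`-linear derivation of `A`, as a differential operator. -/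
def DiffOp.ofDer (δ : Derivation k A A) : DiffOp k A :=
  ⟨(δ : A →ₗ[k] A), 1, fun a => by
    have h : (δ : Module.End k A) * Algebra.lmul k A a - Algebra.lmul k A a * (δ : A →ₗ[k] A) =
        Algebra.lmul k A (δ a) := by
      ext b; simp [mul_comm]
    rw [h]; exact IsDiffOp.lmul _⟩

lemma DiffOp.ofFun_apply (a b : A) : (DiffOp.ofFun a : DiffOp k A).toEnd b = a * b := rfl

lemma DiffOp.ofDer_apply (δ : Derivation k A A) (b : A) :
    (DiffOp.ofDer δ : DiffOp k A).toEnd b = δ b := rfl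

end DiffOp

section Monomials

variable {S : Type u} [Monoid S] {n : ℕ}

lemma dpow_aux (d : Fin n → S) (hd : ∀ i j, Commute (d i) (d j)) :
    Pairwise fun i j => ∀ x y : Multiplicative ℕ,
      Commute (powersHom S (d i) x) (powersHom S (d j) y) :=
  fun i j _ x y => by simpa [powersHom_apply] using (hd i j).pow_pow _ _

/-- The monomial `d₁ ^ α₁ ⋯ dₙ ^ αₙ` in pairwise commuting elements `dᵢ`. -/
def dpow (d : Fin n → S) (hd : ∀ i j, Commute (d i) (d j)) (α : Fin n →₀ ℕ) : S :=
  MonoidHom.noncommPiCoprod (N := fun _ : Fin n => Multiplicative ℕ)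
    (fun i => powersHom S (d i))
    (dpow_aux d hd)
    (fun i => Multiplicative.ofAdd (α i))

variable {d : Fin n → S} {hd : ∀ i j, Commute (d i) (d j)}

lemma dpow_zero : dpow d hd 0 = 1 := map_one (MonoidHom.noncommPiCoprod _ _)

lemma dpow_add (α β : Fin n →₀ ℕ) : dpow d hd (α + β) = dpow d hd α * dpow d hd β :=
  map_mul (MonoidHom.noncommPiCoprod _ _) _ _

lemma dpow_single (i : Fin n) : dpow d hd (Finsupp.single i 1) = d i := by
  have h : (fun j => Multiplicative.ofAdd ((Finsupp.single i 1 : Fin n →₀ ℕ) j)) =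
      (Pi.mulSingle i (Multiplicative.ofAdd 1) : Fin n → Multiplicative ℕ) := by
    funext j
    by_cases hj : j = i
    · subst hj; simp
    · simp [hj]
  rw [dpow, h, MonoidHom.noncommPiCoprod_mulSingle]
  simp [powersHom_apply]

lemma dpow_mem {P : Submonoid S} (h : ∀ i, d i ∈ P) (α : Fin n →₀ ℕ) : dpow d hd α ∈ P := by
  induction hs : α.degree generalizing α with
  | zero =>
    obtain rfl := (Finsupp.degree_eq_zero_iff α).1 hs
    rw [dpow_zero]; exact P.one_mem
  | succ s ih =>
    have : α ≠ 0 := by rintro rfl; simp at hs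
    obtain ⟨i, hi⟩ := Finsupp.ne_iff.1 this
    have hle : Finsupp.single i 1 ≤ α := by
      rw [Finsupp.single_le_iff]; simp at hi; omega
    rw [← tsub_add_cancel_of_le hle, dpow_add, dpow_single]
    refine P.mul_mem (ih _ ?_) (h i)
    have := congrArg Finsupp.degree (tsub_add_cancel_of_le hle)
    rw [map_add, Finsupp.degree_single] at this
    omega

end Monomials

/-- Coordinates `x₁, …, xₙ` on a `k`-algebra with commuting dual derivations `∂₁, …, ∂ₙ`, where
a `k`-linear operator is determined by its value at `1` if it commutes with the coordinates. -/
class Coordinates (k A : Type u) [Field k] [CommRing A] [Algebra k A] (n : outParam ℕ) where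
  x : Fin n → A
  der : Fin n → Derivation k A A
  der_comm : ∀ i j a, der i (der j a) = der j (der i a)
  der_x : ∀ i j, der i (x j) = if i = j then 1 else 0
  eq_zero : ∀ P : Module.End k A, (∀ i a, P (x i * a) = x i * P a) → P 1 = 0 → P = 0

lemma factorial_ne {k : Type u} [Field k] [CharZero k] {n : ℕ} (α : Fin n →₀ ℕ) : ((α.prod fun _ e => e.factorial : ℕ) : k) ≠ 0 := by
  rw [Nat.cast_ne_zero, Finsupp.prod]
  exact Finset.prod_ne_zero_iff.2 fun i _ => Nat.factorial_ne_zero _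

lemma factorial_mul {k A : Type u} [Field k] [CharZero k] [CommRing A] [Algebra k A] {n : ℕ}
    (α : Fin n →₀ ℕ) :
    algebraMap k A ((α.prod fun _ e => e.factorial : ℕ) : k)⁻¹ *
      ((α.prod fun _ e => e.factorial : ℕ) : A) = 1 := by
  rw [← map_natCast (algebraMap k A), ← map_mul, inv_mul_cancel₀ (factorial_ne α), map_one]

section Normal

variable {k A : Type u} [Field k] [CommRing A] [Algebra k A] {n : ℕ} [Coordinates k A n]

variable (k A) in
/-- The partial derivative `∂ᵢ` as an element of `𝒟(A, k)`. -/
def pd (i : Fin n) : DiffOp k A := DiffOp.ofDer (Coordinates.der i)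

lemma pd_apply (i : Fin n) (a : A) : (pd k A i).toEnd a = Coordinates.der (k := k) i a := rfl

lemma pd_comm (i j : Fin n) : Commute (pd k A i) (pd k A j) :=
  DiffOp.ext (LinearMap.ext fun a => Coordinates.der_comm i j a)

lemma pd_mul_ofFun (i : Fin n) (a : A) :
    pd k A i * DiffOp.ofFun a =
      DiffOp.ofFun a * pd k A i + DiffOp.ofFun (Coordinates.der (k := k) i a) := by
  refine DiffOp.ext (LinearMap.ext fun b => ?_)
  change Coordinates.der (k := k) i (a * b) = a * Coordinates.der (k := k) i b +
    Coordinates.der (k := k) i a * b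
  simp [mul_comm]

variable (k) in
def xpow (α : Fin n →₀ ℕ) : A := α.prod fun i e => (Coordinates.x k i : A) ^ e

lemma xpow_add (α β : Fin n →₀ ℕ) : xpow k (α + β) = (xpow k α * xpow k β : A) :=
  Finsupp.prod_add_index' (by simp) (fun _ _ _ => pow_add _ _ _)

lemma xpow_single (i : Fin n) : xpow k (Finsupp.single i 1) = (Coordinates.x k i : A) := by
  simp [xpow]

lemma der_xpow (i : Fin n) (β : Fin n →₀ ℕ) :
    Coordinates.der (k := k) i (xpow k β : A) =
      (β i : A) * xpow k (β - Finsupp.single i 1) := by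
  induction hs : β.degree generalizing β with
  | zero =>
    obtain rfl := (Finsupp.degree_eq_zero_iff β).1 hs
    simp [xpow]
  | succ s ih =>
    have : β ≠ 0 := by rintro rfl; simp at hs
    obtain ⟨j, hj⟩ := Finsupp.ne_iff.1 this
    have hle : Finsupp.single j 1 ≤ β := by
      rw [Finsupp.single_le_iff]; simp at hj; omega
    obtain ⟨γ, rfl⟩ := exists_add_of_le hle
    rw [map_add, Finsupp.degree_single] at hs
    rw [xpow_add, Derivation.leibniz, ih γ (by omega), xpow_single, Coordinates.der_x]
    by_cases hij : i = j
    · subst hij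
      by_cases hγ : γ i = 0
      · simp [hγ]
      · have h2 : Finsupp.single i 1 ≤ γ := by
          rw [Finsupp.single_le_iff]; omega
        obtain ⟨δ, rfl⟩ := exists_add_of_le h2
        simp [xpow_add, xpow_single]
        ring
    · by_cases hγ : γ i = 0
      · simp [hγ, hij]
      · have h2 : Finsupp.single i 1 ≤ γ := by
          rw [Finsupp.single_le_iff]; omega
        obtain ⟨δ, rfl⟩ := exists_add_of_le h2
        rw [add_left_comm]
        simp [xpow_add, xpow_single, hij]
        ring

variable (k A) in
/-- The operator `∂ ^ α`. -/
def pdPow (α : Fin n →₀ ℕ) : DiffOp k A := dpow (pd k A) pd_comm α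

lemma pdPow_xpow (α β : Fin n →₀ ℕ) (h : β.degree ≤ α.degree) :
    (pdPow k A α).toEnd (xpow k β) = if α = β then ((α.prod fun _ e => e.factorial : ℕ) : A) else 0 := by
  induction hs : α.degree generalizing α β with
  | zero =>
    obtain rfl := (Finsupp.degree_eq_zero_iff α).1 hs
    obtain rfl := (Finsupp.degree_eq_zero_iff β).1 (by omega)
    simp [pdPow, dpow_zero, xpow]
  | succ s ih =>
    have : α ≠ 0 := by rintro rfl; simp at hs
    obtain ⟨j, hj⟩ := Finsupp.ne_iff.1 this
    have hle : Finsupp.single j 1 ≤ α := by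
      rw [Finsupp.single_le_iff]; simp at hj; omega
    obtain ⟨γ, rfl⟩ := exists_add_of_le hle
    have hd : γ.degree = s := by
      rw [map_add, Finsupp.degree_single] at hs; omega
    have e : (pdPow k A (Finsupp.single j 1 + γ)).toEnd (xpow k β) =
        (pdPow k A γ).toEnd (Coordinates.der (k := k) j (xpow k β)) := by
      rw [add_comm, pdPow, dpow_add, dpow_single]; rfl
    rw [e, der_xpow, ← nsmul_eq_mul, map_nsmul]
    by_cases hβ : β j = 0
    · rw [hβ, zero_smul, if_neg]
      rintro rfl
      simp at hβ
    · have h2 : Finsupp.single j 1 ≤ β := by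
          rw [Finsupp.single_le_iff]; omega
      obtain ⟨δ, rfl⟩ := exists_add_of_le h2
      rw [map_add, map_add] at h
      rw [add_tsub_cancel_left, ih γ δ (by omega) hd]
      by_cases hγδ : γ = δ
      · subst hγδ
        simp only [if_true]
        rw [nsmul_eq_mul, ← Nat.cast_mul]
        congr 1
        rw [Finsupp.prod_fintype _ _ (by simp), Finsupp.prod_fintype _ _ (by simp),
          ← Finset.mul_prod_erase _ _ (Finset.mem_univ j),
          ← Finset.mul_prod_erase _ _ (Finset.mem_univ j), ← mul_assoc]
        congr 1
        · simp [add_comm 1, Nat.factorial_succ]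
        · refine Finset.prod_congr rfl fun i hi => ?_
          simp [Finset.ne_of_mem_erase hi]
      · simp [hγδ]

section Sum

variable {S : Type u} [Ring S]

/-- The sum `∑ φ(f_α) d ^ α`. -/
def normalSum (φ : A →+* S) (d : Fin n → S) (hd : ∀ i j, Commute (d i) (d j)) :
    ((Fin n →₀ ℕ) →₀ A) →+ S :=
  Finsupp.liftAddHom fun α => (AddMonoidHom.mulRight (dpow d hd α)).comp φ.toAddMonoidHom

lemma normalSum_single (φ : A →+* S) (d : Fin n → S) (hd : ∀ i j, Commute (d i) (d j))
    (α : Fin n →₀ ℕ) (a : A) :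
    normalSum φ d hd (Finsupp.single α a) = φ a * dpow d hd α := by
  simp [normalSum]

end Sum

variable (k A) in
def normalD : ((Fin n →₀ ℕ) →₀ A) →+ DiffOp k A :=
  normalSum DiffOp.ofFun (pd k A) pd_comm

lemma normalD_apply (f : (Fin n →₀ ℕ) →₀ A) (b : A) :
    (normalD k A f).toEnd b = f.sum fun α a => a * (pdPow k A α).toEnd b := by
  induction f using Finsupp.induction_linear with
  | zero => simp
  | add f g hf hg =>
    rw [map_add, Finsupp.sum_add_index' (by simp) (by intros; ring), ← hf, ← hg]; rfl
  | single α a =>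
    rw [normalD, normalSum_single, Finsupp.sum_single_index (by simp)]; rfl

lemma IsDiffOp.sum_mem {ι : Type*} {m : ℕ} (s : Finset ι) {P : ι → DiffOp k A}
    (h : ∀ i ∈ s, IsDiffOp k A m (P i).toEnd) : IsDiffOp k A m (∑ i ∈ s, P i).toEnd := by
  induction s using Finset.cons_induction with
  | empty => exact IsDiffOp.zero_op _
  | cons a s ha ih =>
    rw [Finset.sum_cons]
    exact (h a (by simp)).add (ih fun i hi => h i (by simp [hi]))

lemma pdPow_order (α : Fin n →₀ ℕ) : IsDiffOp k A α.degree (pdPow k A α).toEnd := by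
  induction hs : α.degree generalizing α with
  | zero =>
    obtain rfl := (Finsupp.degree_eq_zero_iff α).1 hs
    rw [pdPow, dpow_zero]
    have := IsDiffOp.lmul (k := k) (1 : A)
    rwa [map_one] at this
  | succ s ih =>
    have : α ≠ 0 := by rintro rfl; simp at hs
    obtain ⟨i, hi⟩ := Finsupp.ne_iff.1 this
    have hle : Finsupp.single i 1 ≤ α := by
      rw [Finsupp.single_le_iff]; simp at hi; omega
    obtain ⟨γ, rfl⟩ := exists_add_of_le hle
    rw [map_add, Finsupp.degree_single] at hs
    rw [add_comm s 1, pdPow, dpow_add, dpow_single, DiffOp.toEnd_mul]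
    refine IsDiffOp.mul (m := 1) ?_ (ih γ (by omega))
    intro a
    have h : (pd k A i).toEnd * Algebra.lmul k A a - Algebra.lmul k A a * (pd k A i).toEnd =
        Algebra.lmul k A (Coordinates.der (k := k) i a) := by
      ext b; simp [pd_apply, mul_comm]
    rw [h]; exact IsDiffOp.lmul _

lemma eq_zero_of_xpow (m : ℕ) (P : Module.End k A) (hP : IsDiffOp k A m P)
    (h : ∀ α : Fin n →₀ ℕ, α.degree < m + 1 → P (xpow k α) = 0) : P = 0 := by
  have h1 : P 1 = 0 := by simpa [xpow] using h 0 (by simp)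
  induction m generalizing P with
  | zero =>
    refine Coordinates.eq_zero P (fun i a => ?_) h1
    have := LinearMap.congr_fun (hP (Coordinates.x k i)) a
    simpa [sub_eq_zero] using this
  | succ m ih =>
    refine Coordinates.eq_zero P (fun i a => ?_) h1
    have hx : ∀ α : Fin n →₀ ℕ, α.degree < m + 1 →
        (P * Algebra.lmul k A (Coordinates.x k i) -
          Algebra.lmul k A (Coordinates.x k i) * P) (xpow k α) = 0 := by
      intro α hα
      have e1 := h α (by omega)
      have e2 := h (Finsupp.single i 1 + α) (by rw [map_add, Finsupp.degree_single]; omega)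
      rw [xpow_add, xpow_single] at e2
      simp [e1, e2]
    have := ih _ (hP (Coordinates.x k i)) hx (by simpa [xpow] using hx 0 (by simp))
    have := LinearMap.congr_fun this a
    simpa [sub_eq_zero] using this

variable [CharZero k]

lemma normalD_injective : Function.Injective (normalD k A) := by
  rw [injective_iff_map_eq_zero]
  intro f hf
  have key : ∀ s, ∀ α : Fin n →₀ ℕ, α.degree = s → f α = 0 := by
    intro s
    induction s using Nat.strong_induction_on with
    | _ s ih =>
      intro α hα
      have h : (normalD k A f).toEnd (xpow k α) = 0 := by rw [hf]; rfl
      rw [normalD_apply, Finsupp.sum, Finset.sum_eq_single α] at h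
      · rw [pdPow_xpow _ _ le_rfl, if_pos rfl] at h
        rw [← one_mul (f α), ← factorial_mul (k := k) α, mul_assoc, mul_comm _ (f α), h, mul_zero]
      · intro β _ hβ
        by_cases hlt : β.degree < s
        · rw [ih _ hlt β rfl, zero_mul]
        · rw [pdPow_xpow _ _ (by omega), if_neg hβ, mul_zero]
      · intro hα'
        rw [Finsupp.notMem_support_iff.1 hα', zero_mul]
  ext α
  exact key _ α rfl

lemma exists_normal_agree (P : Module.End k A) (m : ℕ) :
    ∃ f, IsDiffOp k A (m - 1) (normalD k A f).toEnd ∧ ∀ α : Fin n →₀ ℕ, α.degree < m → (normalD k A f).toEnd (xpow k α) = P (xpow k α) := by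
  induction m with
  | zero => exact ⟨0, by rw [map_zero]; exact IsDiffOp.zero_op _, fun _ h => by omega⟩
  | succ m ih =>
    obtain ⟨f, hford, hf⟩ := ih
    have hfin : Set.Finite {α : Fin n →₀ ℕ | α.degree = m} := by
      refine (Finset.finite_toSet (Finset.finsuppAntidiag Finset.univ m)).subset fun α hα => ?_
      simp only [Finset.mem_coe, Finset.mem_finsuppAntidiag]
      exact ⟨by rw [← hα, Finsupp.degree_eq_sum], Finset.subset_univ _⟩
    let c : (Fin n →₀ ℕ) → A := fun α =>
      algebraMap k A ((α.prod fun _ e => e.factorial : ℕ) : k)⁻¹ *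
        (P (xpow k α) - (normalD k A f).toEnd (xpow k α))
    let g : (Fin n →₀ ℕ) →₀ A := ∑ α ∈ hfin.toFinset, Finsupp.single α (c α)
    have hg : ∀ β : Fin n →₀ ℕ, (normalD k A g).toEnd (xpow k β) =
        ∑ α ∈ hfin.toFinset, c α * (pdPow k A α).toEnd (xpow k β) := by
      intro β
      rw [normalD_apply, ← Finsupp.sum_finsetSum_index (by simp) (by intros; ring)]
      refine Finset.sum_congr rfl fun α _ => ?_
      rw [Finsupp.sum_single_index (by simp)]
    refine ⟨f + g, ?_, fun β hβ => ?_⟩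
    · rw [map_add]
      refine IsDiffOp.add (hford.mono (by omega)) ?_
      rw [map_sum]
      refine IsDiffOp.sum_mem _ fun α hα => ?_
      have hα' : α.degree = m := by simpa using hα
      rw [normalD, normalSum_single, Nat.add_sub_cancel, ← hα', ← zero_add α.degree]
      exact (IsDiffOp.lmul _).mul (pdPow_order α)
    have e : (normalD k A (f + g)).toEnd (xpow k β) =
        (normalD k A f).toEnd (xpow k β) + (normalD k A g).toEnd (xpow k β) := by
      rw [map_add]; rfl
    rw [e, hg]
    by_cases hm : β.degree = m
    · rw [Finset.sum_eq_single β]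
      · rw [pdPow_xpow _ _ le_rfl, if_pos rfl, mul_right_comm, factorial_mul]
        ring
      · intro α hα hαβ
        have : α.degree = m := by simpa using hα
        rw [pdPow_xpow _ _ (by omega), if_neg hαβ, mul_zero]
      · intro h; simp [hm] at h
    · rw [Finset.sum_eq_zero, add_zero, hf β (by omega)]
      intro α hα
      have : α.degree = m := by simpa using hα
      rw [pdPow_xpow _ _ (by omega), if_neg, mul_zero]
      rintro rfl; exact hm this

lemma normalD_surjective : Function.Surjective (normalD k A) := by
  intro P
  obtain ⟨m, hm⟩ := P.2
  obtain ⟨f, hford, hf⟩ := exists_normal_agree P.toEnd (m + 1)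
  refine ⟨f, ?_⟩
  rw [← sub_eq_zero]
  refine DiffOp.ext (eq_zero_of_xpow m (normalD k A f - P).toEnd ?_ fun α hα => ?_)
  · have h := IsDiffOp.add hford ((IsDiffOp.lmul (-1 : A)).mul hm |>.mono (by omega))
    rw [Nat.add_sub_cancel] at h
    have e : (normalD k A f - P).toEnd = (normalD k A f).toEnd + Algebra.lmul k A (-1) * P.toEnd := by
      ext b
      simp [sub_eq_add_neg]
    rwa [e]
  · change (normalD k A f).toEnd (xpow k α) - P.toEnd (xpow k α) = 0
    rw [hf α hα, sub_self]

/-- The coefficients of a differential operator: `P = ∑ f_α ∂ ^ α`. -/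
def normalEquiv : ((Fin n →₀ ℕ) →₀ A) ≃+ DiffOp k A :=
  AddEquiv.ofBijective (normalD k A) ⟨normalD_injective, normalD_surjective⟩

lemma normalEquiv_single (α : Fin n →₀ ℕ) (a : A) :
    normalEquiv (Finsupp.single α a) = DiffOp.ofFun a * pdPow k A α :=
  normalSum_single _ _ _ _ _

/-- `𝒟(A, k)` is generated by `A` and the `∂ᵢ`. -/
lemma DiffOp.induction_gen {p : DiffOp k A → Prop} (hf : ∀ a : A, p (DiffOp.ofFun a))
    (hd : ∀ i, p (pd k A i)) (hadd : ∀ P Q, p P → p Q → p (P + Q))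
    (hmul : ∀ P Q, p P → p Q → p (P * Q)) (P : DiffOp k A) : p P := by
  obtain ⟨f, rfl⟩ := normalEquiv.surjective P
  have h1 : p 1 := by simpa using hf 1
  let T : Submonoid (DiffOp k A) :=
    { carrier := {P | p P}, one_mem' := h1, mul_mem' := fun h h' => hmul _ _ h h' }
  induction f using Finsupp.induction_linear with
  | zero => simpa using hf 0
  | add f g h h' => rw [map_add]; exact hadd _ _ h h'
  | single α a =>
    rw [normalEquiv_single]
    exact hmul _ _ (hf a) (dpow_mem (P := T) hd α)

section Lift

variable {S : Type u} [Ring S] (φ : A →+* S) (d : Fin n → S)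
  (hd : ∀ i j, Commute (d i) (d j))

/-- Auxiliary additive version of `DiffOp.lift`. -/
def liftAux : DiffOp k A →+ S := (normalSum φ d hd).comp normalEquiv.symm.toAddMonoidHom

lemma liftAux_single (α : Fin n →₀ ℕ) (a : A) :
    liftAux φ d hd (DiffOp.ofFun a * pdPow k A α) = φ a * dpow d hd α := by
  rw [← normalEquiv_single]
  simp [liftAux, normalSum_single]

lemma liftAux_ofFun (a : A) : liftAux φ d hd (DiffOp.ofFun a : DiffOp k A) = φ a := by
  have := liftAux_single (k := k) φ d hd 0 a
  simpa [pdPow, dpow_zero] using this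

lemma liftAux_pd (i : Fin n) : liftAux φ d hd (pd k A i) = d i := by
  have := liftAux_single (k := k) φ d hd (Finsupp.single i 1) 1
  simpa [pdPow, dpow_single] using this

lemma liftAux_mul
    (hφ : ∀ i a, d i * φ a = φ a * d i + φ (Coordinates.der (k := k) i a)) (P Q : DiffOp k A) :
    liftAux φ d hd (P * Q) = liftAux φ d hd P * liftAux φ d hd Q := by
  revert Q
  refine DiffOp.induction_gen
    (p := fun P => ∀ Q, liftAux φ d hd (P * Q) = liftAux φ d hd P * liftAux φ d hd Q)
    ?_ ?_ ?_ ?_ P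
  · intro a Q
    obtain ⟨f, rfl⟩ := normalEquiv.surjective Q
    induction f using Finsupp.induction_linear with
    | zero => simp
    | add f g h h' => rw [map_add, mul_add, map_add, map_add, mul_add, h, h']
    | single α b =>
      rw [normalEquiv_single, ← mul_assoc, ← map_mul, liftAux_single, liftAux_single,
        liftAux_ofFun, map_mul, mul_assoc]
  · intro i Q
    obtain ⟨f, rfl⟩ := normalEquiv.surjective Q
    induction f using Finsupp.induction_linear with
    | zero => simp
    | add f g h h' => rw [map_add, mul_add, map_add, map_add, mul_add, h, h']
    | single α b =>
      have e : pd k A i * pdPow k A α = pdPow k A (Finsupp.single i 1 + α) := by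
        rw [pdPow, pdPow, dpow_add, dpow_single]
      rw [normalEquiv_single, ← mul_assoc, pd_mul_ofFun, add_mul, mul_assoc, e, map_add,
        liftAux_single, liftAux_single, liftAux_single, liftAux_pd, dpow_add, dpow_single,
        ← mul_assoc, ← mul_assoc, hφ, add_mul]
  · intro P P' h h' Q
    rw [add_mul, map_add, map_add, add_mul, h, h']
  · intro P P' h h' Q
    rw [mul_assoc, h, h', h, mul_assoc]

variable (hφ : ∀ i a, d i * φ a = φ a * d i + φ (Coordinates.der (k := k) i a))

/-- A ring homomorphism out of `𝒟(A, k)` is the same as a ring homomorphism `φ` out of `A`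
together with pairwise commuting elements `dᵢ` such that `dᵢ φ(a) - φ(a) dᵢ = φ(∂ᵢ a)`. -/
def DiffOp.lift : DiffOp k A →+* S :=
  { liftAux φ d hd with
    map_one' := by
      have := liftAux_ofFun (k := k) φ d hd 1
      simpa using this
    map_mul' := liftAux_mul φ d hd hφ }

lemma DiffOp.lift_ofFun (a : A) : DiffOp.lift φ d hd hφ (DiffOp.ofFun a : DiffOp k A) = φ a :=
  liftAux_ofFun φ d hd a

lemma DiffOp.lift_pd (i : Fin n) : DiffOp.lift φ d hd hφ (pd k A i) = d i :=
  liftAux_pd φ d hd i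

end Lift

end Normal

section Rings

variable (k : Type u) [Field k] (n : ℕ)

/-- `R = k[x₁, …, xₙ]`. -/
abbrev Poly : Type u := MvPolynomial (Fin n) k

/-- `R̂ = k[[x₁, …, xₙ]]`. -/
abbrev Series : Type u := MvPowerSeries (Fin n) k

lemma poly_eq_zero (P : Module.End k (Poly k n))
    (h : ∀ i a, P (MvPolynomial.X i * a) = MvPolynomial.X i * P a) (h1 : P 1 = 0) : P = 0 := by
  refine LinearMap.ext fun f => ?_
  induction f using MvPolynomial.induction_on with
  | C a => rw [MvPolynomial.C_eq_smul_one, map_smul, h1, smul_zero]; rfl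
  | add p q hp hq => rw [map_add, hp, hq]; simp
  | mul_X p i hp => rw [mul_comm, h, hp]; simp

lemma series_split (f : Series k n) : ∃ g : Fin n → Series k n,
    f = MvPowerSeries.C (MvPowerSeries.coeff 0 f) + ∑ i, MvPowerSeries.X i * g i := by
  classical
  let g : Fin n → Series k n := fun i d =>
    if ∀ j, j < i → d j = 0 then MvPowerSeries.coeff (d + Finsupp.single i 1) f else 0
  have hg : ∀ i d, MvPowerSeries.coeff d (g i) =
      if ∀ j, j < i → d j = 0 then MvPowerSeries.coeff (d + Finsupp.single i 1) f else 0 :=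
    fun i d => rfl
  refine ⟨g, ?_⟩
  ext d
  have hc : ∀ (i : Fin n) (g : Series k n), MvPowerSeries.coeff d (MvPowerSeries.X i * g) =
      if d i ≠ 0 then MvPowerSeries.coeff (d - Finsupp.single i 1) g else 0 := by
    intro i g
    rw [MvPowerSeries.X_def, MvPowerSeries.coeff_monomial_mul]
    simp only [Finsupp.single_le_iff, one_mul, Nat.one_le_iff_ne_zero]
  rw [map_add, map_sum, MvPowerSeries.coeff_C]
  simp only [hc]
  clear_value g
  by_cases hd : d = 0
  · subst hd; simp
  · rw [if_neg hd, zero_add]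
    have hne : (Finset.univ.filter fun i => d i ≠ 0).Nonempty := by
      obtain ⟨i, hi⟩ := Finsupp.ne_iff.1 hd
      exact ⟨i, by simpa using hi⟩
    set m := (Finset.univ.filter fun i => d i ≠ 0).min' hne with hm
    have hm1 : d m ≠ 0 := by
      have := Finset.min'_mem _ hne
      simpa using this
    have hm2 : ∀ j, j < m → d j = 0 := by
      intro j hj
      by_contra hj'
      have := Finset.min'_le (Finset.univ.filter fun i => d i ≠ 0) j (by simpa using hj')
      exact absurd hj (not_lt.2 this)
    have hle : Finsupp.single m 1 ≤ d := by
      rw [Finsupp.single_le_iff]; omega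
    rw [Finset.sum_eq_single m]
    · rw [if_pos hm1]
      rw [hg, if_pos, tsub_add_cancel_of_le hle]
      intro j hj
      simp [hm2 j hj]
    · intro i _ him
      by_cases hi : d i ≠ 0
      · rw [if_pos hi]
        rw [hg, if_neg]
        intro h
        have hlt : m < i := lt_of_le_of_ne
          (Finset.min'_le (Finset.univ.filter fun i => d i ≠ 0) i (by simpa using hi)) (Ne.symm him)
        have := h m hlt
        simp [hlt.ne'] at this
        exact hm1 this
      · rw [if_neg hi]
    · simp

lemma series_eq_zero (P : Module.End k (Series k n))
    (h : ∀ i a, P (MvPowerSeries.X i * a) = MvPowerSeries.X i * P a) (h1 : P 1 = 0) : P = 0 := by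
  have key : ∀ m, ∀ (f : Series k n) (d : Fin n →₀ ℕ), d.degree < m →
      MvPowerSeries.coeff d (P f) = 0 := by
    intro m
    induction m with
    | zero => intro _ _ h; omega
    | succ m ih =>
      intro f d hd
      obtain ⟨g, hg⟩ := series_split k n f
      have hC : P (MvPowerSeries.C (MvPowerSeries.coeff 0 f)) = 0 := by
        have : (MvPowerSeries.C (MvPowerSeries.coeff 0 f) : Series k n) =
            (MvPowerSeries.coeff 0 f) • 1 := by
          rw [MvPowerSeries.smul_eq_C_mul, mul_one]
        rw [this, map_smul, h1, smul_zero]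
      rw [hg, map_add, hC, zero_add, map_sum, map_sum]
      refine Finset.sum_eq_zero fun i _ => ?_
      rw [h, MvPowerSeries.X_def, MvPowerSeries.coeff_monomial_mul]
      split_ifs with hle
      · rw [ih, mul_zero]
        have := congrArg Finsupp.degree (tsub_add_cancel_of_le hle)
        rw [map_add, Finsupp.degree_single] at this
        omega
      · rfl
  ext f d
  exact key _ f d (Nat.lt_succ_self _)

instance polyCoordinates : Coordinates k (Poly k n) n where
  x := MvPolynomial.X
  der := MvPolynomial.pderiv
  der_comm i j a := by
    induction a using MvPolynomial.induction_on with
    | C a => simp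
    | add p q hp hq => simp [hp, hq]
    | mul_X p l hp =>
      simp only [Derivation.leibniz, smul_eq_mul, map_add, hp, MvPolynomial.pderiv_X]
      have hs : ∀ a b : Fin n, MvPolynomial.pderiv a
          (Pi.single (M := fun _ => MvPolynomial (Fin n) k) b 1 l) = 0 := by
        intro a b
        rw [Pi.single_apply]; split_ifs <;> simp
      rw [hs, hs]
      ring
  der_x i j := by
    simp [MvPolynomial.pderiv_X, Pi.single_apply, eq_comm]
  eq_zero := poly_eq_zero k n

instance seriesCoordinates : Coordinates k (Series k n) n where
  x := MvPowerSeries.X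
  der := MvPowerSeries.pderiv k
  der_comm i j a := by
    ext d
    simp only [MvPowerSeries.coeff_pderiv]
    by_cases h : i = j
    · subst h; rfl
    · rw [add_right_comm]
      simp [h, Ne.symm h]
      ring
  der_x i j := by
    simp [MvPowerSeries.pderiv_X, eq_comm, Pi.single_apply]
  eq_zero := series_eq_zero k n

/-- `𝒟 = 𝒟(R, k)`. -/
abbrev D : Type u := DiffOp k (Poly k n)

/-- `𝒟̂ = 𝒟(R̂, k)`. -/
abbrev DHat : Type u := DiffOp k (Series k n)

variable [CharZero k]

/-- The inclusion `𝒟 ⊆ 𝒟̂`: it extends `R ⊆ R̂` and sends `∂ᵢ` to `∂ᵢ`. -/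
def toHat : D k n →+* DHat k n :=
  DiffOp.lift (DiffOp.ofFun.comp MvPolynomial.coeToMvPowerSeries.ringHom)
    (pd k (Series k n)) pd_comm
    (fun i a => by
      simp only [RingHom.comp_apply, pd_mul_ofFun]
      congr 2
      exact MvPowerSeries.pderiv_coe a)

end Rings

instance DiffOp.smulCommClass {k A : Type u} [CommRing k] [CommRing A] [Algebra k A] :
    SMulCommClass k (DiffOp k A) A :=
  ⟨fun c P a => (map_smul P.toEnd c a).symm⟩

section Transposition

variable {k A : Type u} [Field k] [CharZero k] [CommRing A] [Algebra k A] {n : ℕ}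
  [Coordinates k A n]

/-- The standard transposition `τ`, with `τ(f ∂ ^ α) = (-1) ^ |α| ∂ ^ α f`, as an anti-homomorphism
of `𝒟(A, k)`: it fixes `A` and sends `∂ᵢ` to `-∂ᵢ`. -/
def tau : DiffOp k A →+* (DiffOp k A)ᵐᵒᵖ :=
  DiffOp.lift ((DiffOp.ofFun (k := k) (A := A)).toOpposite
      (fun a b => by rw [commute_iff_eq, ← map_mul, mul_comm, map_mul]))
    (fun i => MulOpposite.op (-pd k A i))
    (fun i j => by
      exact congrArg MulOpposite.op ((pd_comm (k := k) (A := A) j i).neg_left.neg_right).eq)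
    (fun i a => by
      refine congrArg MulOpposite.op ?_
      have h := pd_mul_ofFun (k := k) i a
      have aux : ∀ {S : Type u} [Ring S] (p f g : S), p * f = f * p + g → f * -p = -p * f + g := by
        intro S _ p f g h
        rw [mul_neg, neg_mul, h]; abel
      exact aux _ _ _ h)

lemma tau_normal (f : A) (α : Fin n →₀ ℕ) :
    (tau (DiffOp.ofFun f * pdPow k A α)).unop =
      (-1) ^ α.degree * (pdPow k A α * DiffOp.ofFun f) := by
  have hp : (tau (pdPow k A α)).unop = (-1) ^ α.degree * pdPow k A α := by
    induction hs : α.degree generalizing α with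
    | zero =>
      obtain rfl := (Finsupp.degree_eq_zero_iff α).1 hs
      simp [pdPow, dpow_zero]
    | succ s ih =>
      have : α ≠ 0 := by rintro rfl; simp at hs
      obtain ⟨i, hi⟩ := Finsupp.ne_iff.1 this
      have hle : Finsupp.single i 1 ≤ α := by
        rw [Finsupp.single_le_iff]; simp at hi; omega
      obtain ⟨γ, rfl⟩ := exists_add_of_le hle
      rw [map_add, Finsupp.degree_single] at hs
      have e : pdPow k A (Finsupp.single i 1 + γ) = pd k A i * pdPow k A γ := by
        rw [pdPow, pdPow, dpow_add, dpow_single]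
      have e' : pdPow k A (Finsupp.single i 1 + γ) = pdPow k A γ * pd k A i := by
        rw [add_comm, pdPow, pdPow, dpow_add, dpow_single]
      have ht : tau (pd k A i) = MulOpposite.op (-pd k A i) := DiffOp.lift_pd _ _ _ _ i
      rw [e, map_mul, MulOpposite.unop_mul, ih γ (by omega), ht, ← e, e', MulOpposite.unop_op,
        pow_succ]
      have aux : ∀ {S : Type u} [Ring S] (p f g : S), g * f * -p = g * -1 * (f * p) := by
        intro S _ p f g; noncomm_ring
      exact aux _ _ _
  have hf : tau (DiffOp.ofFun f : DiffOp k A) = MulOpposite.op (DiffOp.ofFun f) :=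
    DiffOp.lift_ofFun _ _ _ _ f
  rw [map_mul, MulOpposite.unop_mul, hp, hf, MulOpposite.unop_op, mul_assoc]

/-- `τ` as a ring homomorphism out of the opposite ring. -/
def tauOp : (DiffOp k A)ᵐᵒᵖ →+* DiffOp k A where
  toFun P := (tau P.unop).unop
  map_one' := by simp
  map_mul' P Q := by simp
  map_zero' := by simp
  map_add' P Q := by simp

/-- The transpose `M^τ` of a left `𝒟(A, k)`-module `M`: the same abelian group, with the right
action `m · P = τ(P) m`. Right modules are modules over the opposite ring. -/
def Transpose (M : Type u) : Type u := M

variable {M : Type u}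

instance [AddCommGroup M] : AddCommGroup (Transpose M) := inferInstanceAs (AddCommGroup M)

instance [AddCommGroup M] [Module k M] : Module k (Transpose M) := inferInstanceAs (Module k M)

instance transposeModule [AddCommGroup M] [Module (DiffOp k A) M] :
    Module (DiffOp k A)ᵐᵒᵖ (Transpose M) :=
  Module.compHom M (tauOp (k := k) (A := A))

instance [AddCommGroup M] [Module k M] [Module (DiffOp k A) M] [SMulCommClass k (DiffOp k A) M] :
    SMulCommClass k (DiffOp k A)ᵐᵒᵖ (Transpose M) :=
  ⟨fun c P m => smul_comm c (tauOp P) (show M from m)⟩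

end Transposition

section Completion

variable (k : Type u) [Field k] (n : ℕ)

variable (M : Type u) [AddCommGroup M] [Module (D k n) M]

/-- A `𝒟`-module regarded as an `R`-module by restriction of scalars. -/
abbrev asPolyModule : Module (Poly k n) M :=
  Module.compHom M (DiffOp.ofFun : Poly k n →+* D k n)

attribute [local instance] asPolyModule

/-- The completion `M̂ = R̂ ⊗_R M` of a `𝒟`-module `M`. -/
def Completion : Type u := Series k n ⊗[Poly k n] M

instance : AddCommGroup (Completion k n M) :=
  inferInstanceAs (AddCommGroup (Series k n ⊗[Poly k n] M))

instance : Module (Series k n) (Completion k n M) :=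
  inferInstanceAs (Module (Series k n) (Series k n ⊗[Poly k n] M))

variable {M} in
/-- The pure tensor `s ⊗ m` in `M̂`. -/
def Completion.tmul (s : Series k n) (m : M) : Completion k n M :=
  TensorProduct.tmul (Poly k n) s m

variable {M}

lemma Completion.tmul_add (s : Series k n) (m m' : M) :
    Completion.tmul k n s (m + m') = Completion.tmul k n s m + Completion.tmul k n s m' :=
  TensorProduct.tmul_add (R := Poly k n) (N := M) s m m'

lemma Completion.add_tmul (s s' : Series k n) (m : M) :
    Completion.tmul k n (s + s') m = Completion.tmul k n s m + Completion.tmul k n s' m :=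
  TensorProduct.add_tmul (R := Poly k n) (N := M) s s' m

lemma Completion.tmul_ofFun (s : Series k n) (r : Poly k n) (m : M) :
    Completion.tmul k n s ((DiffOp.ofFun r : D k n) • m) =
      Completion.tmul k n ((r : Series k n) * s) m :=
  (TensorProduct.smul_tmul (R := Poly k n) (N := M) r s m).symm

variable (M) in
/-- The operator `∂ᵢ` on `M̂`: `∂ᵢ (s ⊗ m) = ∂ᵢ(s) ⊗ m + s ⊗ ∂ᵢ m`. -/
def Completion.del (i : Fin n) : AddMonoid.End (Completion k n M) :=
  TensorProduct.liftAddHom (R := Poly k n) (M := Series k n) (N := M)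
    (AddMonoidHom.mk' (fun s => AddMonoidHom.mk' (fun m : M =>
        Completion.tmul k n (MvPowerSeries.pderiv k i s) m +
          Completion.tmul k n s (pd k (Poly k n) i • m))
        (fun m m' => by
          rw [smul_add, Completion.tmul_add, Completion.tmul_add]; abel))
      (fun s s' => by
        refine AddMonoidHom.ext fun m => ?_
        change Completion.tmul k n (MvPowerSeries.pderiv k i (s + s')) m +
          Completion.tmul k n (s + s') (pd k (Poly k n) i • m) = (_ + _) + (_ + _)
        rw [map_add, Completion.add_tmul, Completion.add_tmul]
        abel))
    (fun r s m => by
      have h : pd k (Poly k n) i • (DiffOp.ofFun r : D k n) • m =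
          (DiffOp.ofFun r : D k n) • pd k (Poly k n) i • m +
            (DiffOp.ofFun (MvPolynomial.pderiv i r) : D k n) • m := by
        have := congrArg (· • m) (pd_mul_ofFun (k := k) i r)
        simp only [mul_smul, add_smul] at this
        exact this
      have h' : MvPowerSeries.pderiv k i ((r : Series k n) * s) =
          (r : Series k n) * MvPowerSeries.pderiv k i s +
            (MvPolynomial.pderiv i r : Series k n) * s := by
        rw [Derivation.leibniz, MvPowerSeries.pderiv_coe]
        simp [mul_comm]
      change Completion.tmul k n (MvPowerSeries.pderiv k i ((r : Series k n) * s)) m +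
          Completion.tmul k n ((r : Series k n) * s) (pd k (Poly k n) i • m) =
        Completion.tmul k n (MvPowerSeries.pderiv k i s) ((DiffOp.ofFun r : D k n) • m) +
          Completion.tmul k n s (pd k (Poly k n) i • (DiffOp.ofFun r : D k n) • m)
      rw [h, h', Completion.tmul_add, Completion.add_tmul, Completion.tmul_ofFun,
        Completion.tmul_ofFun, Completion.tmul_ofFun]
      abel)

lemma Completion.del_tmul (i : Fin n) (s : Series k n) (m : M) :
    Completion.del k n M i (Completion.tmul k n s m) =
      Completion.tmul k n (MvPowerSeries.pderiv k i s) m +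
        Completion.tmul k n s (pd k (Poly k n) i • m) := rfl

lemma Completion.smul_tmul (r s : Series k n) (m : M) :
    r • Completion.tmul k n s m = Completion.tmul k n (r * s) m := rfl

lemma Completion.addHom_ext {N : Type u} [AddCommGroup N] {f g : Completion k n M →+ N}
    (h : ∀ s m, f (Completion.tmul k n s m) = g (Completion.tmul k n s m)) : f = g := by
  refine AddMonoidHom.ext fun z => ?_
  induction z using TensorProduct.induction_on with
  | zero => exact (map_zero f).trans (map_zero g).symm
  | tmul s m => exact h s m
  | add x y hx hy => exact (map_add f x y).trans ((congrArg₂ _ hx hy).trans (map_add g x y).symm)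

variable [CharZero k]

variable (M) in
/-- The action of `𝒟̂` on `M̂`: elements of `R̂` act by multiplication, and `∂ᵢ` acts through
`Completion.del`. -/
def Completion.action : DHat k n →+* AddMonoid.End (Completion k n M) :=
  DiffOp.lift (Module.toAddMonoidEnd (Series k n) (Completion k n M)) (Completion.del k n M)
    (fun i j => by
      refine Completion.addHom_ext k n fun s m => ?_
      change Completion.del k n M i (Completion.del k n M j (Completion.tmul k n s m)) =
        Completion.del k n M j (Completion.del k n M i (Completion.tmul k n s m))
      simp only [Completion.del_tmul, map_add]
      have h1 : pd k (Poly k n) i • pd k (Poly k n) j • m =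
          pd k (Poly k n) j • pd k (Poly k n) i • m := by
        rw [← mul_smul, ← mul_smul, (pd_comm i j).eq]
      have h2 : MvPowerSeries.pderiv k i (MvPowerSeries.pderiv k j s) =
          MvPowerSeries.pderiv k j (MvPowerSeries.pderiv k i s) :=
        Coordinates.der_comm (A := Series k n) i j s
      rw [h1, h2]; abel)
    (fun i r => by
      refine Completion.addHom_ext k n fun s m => ?_
      change Completion.del k n M i (r • Completion.tmul k n s m) =
        r • Completion.del k n M i (Completion.tmul k n s m) +
          (MvPowerSeries.pderiv k i r) • Completion.tmul k n s m
      rw [Completion.smul_tmul, Completion.smul_tmul, Completion.del_tmul,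
        Completion.del_tmul, Derivation.leibniz, smul_add, Completion.smul_tmul,
        Completion.smul_tmul, Completion.add_tmul, smul_eq_mul, smul_eq_mul,
        mul_comm s]
      abel)

instance Completion.module : Module (DHat k n) (Completion k n M) :=
  Module.compHom _ (Completion.action k n M)

lemma Completion.ofFun_smul (r : Series k n) (z : Completion k n M) :
    (DiffOp.ofFun r : DHat k n) • z = r • z := by
  have h : Completion.action k n M (DiffOp.ofFun r) =
      Module.toAddMonoidEnd (Series k n) (Completion k n M) r := DiffOp.lift_ofFun _ _ _ _ r
  exact congrArg (fun f : AddMonoid.End _ => f z) h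

lemma Completion.pd_smul (i : Fin n) (z : Completion k n M) :
    pd k (Series k n) i • z = Completion.del k n M i z := by
  have h : Completion.action k n M (pd k (Series k n) i) = Completion.del k n M i :=
    DiffOp.lift_pd _ _ _ _ i
  exact congrArg (fun f : AddMonoid.End _ => f z) h

/-- The natural map `κ : M → M̂`, `m ↦ 1 ⊗ m`, is semilinear along `𝒟 ⊆ 𝒟̂`. -/
def Completion.kappa : M →ₛₗ[toHat k n] Completion k n M where
  toFun m := Completion.tmul k n 1 m
  map_add' m m' := Completion.tmul_add k n 1 m m'
  map_smul' P m := by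
    revert m
    refine DiffOp.induction_gen
      (p := fun P : D k n => ∀ m : M, Completion.tmul k n 1 (P • m) =
        toHat k n P • Completion.tmul k n 1 m) ?_ ?_ ?_ ?_ P
    · intro r m
      rw [toHat, DiffOp.lift_ofFun, RingHom.comp_apply, Completion.ofFun_smul,
        Completion.smul_tmul, Completion.tmul_ofFun]
      rfl
    · intro i m
      rw [toHat, DiffOp.lift_pd, Completion.pd_smul, Completion.del_tmul,
        MvPowerSeries.pderiv_one]
      have h0 : Completion.tmul k n 0 m = 0 :=
        TensorProduct.zero_tmul (R := Poly k n) (Series k n) m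
      rw [h0, zero_add]
    · intro P Q hP hQ m
      rw [add_smul, Completion.tmul_add, map_add, add_smul, hP, hQ]
    · intro P Q hP hQ m
      rw [mul_smul, map_mul, mul_smul, hP, hQ]

/-- The inclusion `R^τ → R̂^τ`. -/
def polyToSeries : Transpose (Poly k n) →ₗ[k] Transpose (Series k n) :=
  (MvPolynomial.coeToMvPowerSeries.algHom k : Poly k n →ₐ[k] Series k n).toLinearMap

lemma polyToSeries_smul (P : (D k n)ᵐᵒᵖ) (r : Transpose (Poly k n)) :
    polyToSeries k n (P • r) = MulOpposite.op (toHat k n P.unop) • polyToSeries k n r := by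
  induction P using MulOpposite.rec' with
  | _ P =>
  revert r
  refine DiffOp.induction_gen
    (p := fun P : D k n => ∀ r : Transpose (Poly k n), polyToSeries k n (MulOpposite.op P • r) =
      MulOpposite.op (toHat k n P) • polyToSeries k n r) ?_ ?_ ?_ ?_ P
  · intro f r
    have h1 : tau (DiffOp.ofFun f : D k n) = MulOpposite.op (DiffOp.ofFun f) :=
      DiffOp.lift_ofFun _ _ _ _ f
    have h2 : tau (DiffOp.ofFun (f : Series k n) : DHat k n) =
        MulOpposite.op (DiffOp.ofFun (f : Series k n)) := DiffOp.lift_ofFun _ _ _ _ _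
    have h3 : toHat k n (DiffOp.ofFun f) = DiffOp.ofFun (f : Series k n) :=
      DiffOp.lift_ofFun _ _ _ _ f
    rw [h3]
    change (((tau (DiffOp.ofFun f : D k n)).unop.toEnd r : Poly k n) : Series k n) =
      (tau (DiffOp.ofFun (f : Series k n) : DHat k n)).unop.toEnd ((show Poly k n from r) : Series k n)
    rw [h1, h2]
    exact MvPolynomial.coe_mul f _
  · intro i r
    have h1 : tau (pd k (Poly k n) i) = MulOpposite.op (-pd k (Poly k n) i) :=
      DiffOp.lift_pd _ _ _ _ i
    have h2 : tau (pd k (Series k n) i) = MulOpposite.op (-pd k (Series k n) i) :=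
      DiffOp.lift_pd _ _ _ _ i
    have h3 : toHat k n (pd k (Poly k n) i) = pd k (Series k n) i :=
      DiffOp.lift_pd _ _ _ _ i
    rw [h3]
    change (((tau (pd k (Poly k n) i)).unop.toEnd r : Poly k n) : Series k n) =
      (tau (pd k (Series k n) i)).unop.toEnd ((show Poly k n from r) : Series k n)
    rw [h1, h2]
    revert r
    refine fun r : Poly k n => ?_
    change ((-MvPolynomial.pderiv i r : Poly k n) : Series k n) =
      -MvPowerSeries.pderiv k i (r : Series k n)
    rw [MvPowerSeries.pderiv_coe]
    exact map_neg (MvPolynomial.coeToMvPowerSeries.ringHom (σ := Fin n) (R := k)) _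
  · intro P Q hP hQ r
    rw [MulOpposite.op_add, add_smul, map_add, map_add, MulOpposite.op_add, add_smul, hP, hQ]
  · intro P Q hP hQ r
    rw [MulOpposite.op_mul, mul_smul, map_mul, MulOpposite.op_mul, mul_smul, hQ, hP]

end Completion

section Tensor

variable (k A : Type u) [CommRing k] [Ring A] (N : Type u) [AddCommGroup N] [Module k N]
  [Module Aᵐᵒᵖ N] [SMulCommClass k Aᵐᵒᵖ N] (M : Type u) [AddCommGroup M] [Module A M]

/-- The relations `n a ⊗ m = n ⊗ a m`. -/
def balancedRel : Submodule k (N ⊗[ℤ] M) :=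
  Submodule.span k {z | ∃ (n : N) (a : A) (m : M),
    z = (MulOpposite.op a • n) ⊗ₜ[ℤ] m - n ⊗ₜ[ℤ] (a • m)}

/-- The tensor product `N ⊗_A M` of a right module `N` and a left module `M` over a
noncommutative ring `A`. It is a `k`-module when `N` is a `k`-`A`-bimodule. -/
def BalancedTensor : Type u := (N ⊗[ℤ] M) ⧸ balancedRel k A N M

instance : AddCommGroup (BalancedTensor k A N M) :=
  inferInstanceAs (AddCommGroup ((N ⊗[ℤ] M) ⧸ balancedRel k A N M))

instance : Module k (BalancedTensor k A N M) :=
  inferInstanceAs (Module k ((N ⊗[ℤ] M) ⧸ balancedRel k A N M))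

end Tensor

section TensorMap

variable {k A B : Type u} [CommRing k] [Ring A] [Ring B] (ρ : A →+* B)
  {N N' : Type u} [AddCommGroup N] [Module k N] [Module Aᵐᵒᵖ N] [SMulCommClass k Aᵐᵒᵖ N]
  [AddCommGroup N'] [Module k N'] [Module Bᵐᵒᵖ N'] [SMulCommClass k Bᵐᵒᵖ N']
  {M M' : Type u} [AddCommGroup M] [Module A M] [AddCommGroup M'] [Module B M']

/-- The map `g ⊗ f : N ⊗_A M → N' ⊗_B M'` induced by maps `g` and `f` that are semilinear along
a ring homomorphism `ρ : A → B`. -/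
def BalancedTensor.map (g : N →ₗ[k] N')
    (hg : ∀ (a : A) (x : N), g (MulOpposite.op a • x) = MulOpposite.op (ρ a) • g x)
    (f : M →ₛₗ[ρ] M') : BalancedTensor k A N M →ₗ[k] BalancedTensor k B N' M' :=
  Submodule.mapQ _ _ (TensorProduct.AlgebraTensorModule.map g f.toAddMonoidHom.toIntLinearMap)
    (by
      refine Submodule.span_le.2 ?_
      rintro _ ⟨n, a, m, rfl⟩
      refine Submodule.subset_span ⟨g n, ρ a, f m, ?_⟩
      rw [map_sub]
      change g (MulOpposite.op a • n) ⊗ₜ[ℤ] f m - g n ⊗ₜ[ℤ] f (a • m) = _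
      rw [hg, map_smulₛₗ])

/-- The pure tensor `x ⊗ m`. -/
def BalancedTensor.tmul (x : N) (m : M) : BalancedTensor k A N M :=
  Submodule.Quotient.mk (x ⊗ₜ[ℤ] m)

lemma BalancedTensor.map_tmul (g : N →ₗ[k] N')
    (hg : ∀ (a : A) (x : N), g (MulOpposite.op a • x) = MulOpposite.op (ρ a) • g x)
    (f : M →ₛₗ[ρ] M') (x : N) (m : M) :
    BalancedTensor.map ρ g hg f (BalancedTensor.tmul x m) =
      BalancedTensor.tmul (g x) (f m) := rfl

lemma BalancedTensor.hom_ext {P : Type u} [AddCommGroup P] [Module k P]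
    {f f' : BalancedTensor k A N M →ₗ[k] P}
    (h : ∀ x m, f (BalancedTensor.tmul x m) = f' (BalancedTensor.tmul x m)) : f = f' := by
  refine LinearMap.ext fun z => ?_
  obtain ⟨z, rfl⟩ := Submodule.Quotient.mk_surjective _ z
  induction z using TensorProduct.induction_on with
  | zero => exact (map_zero f).trans (map_zero f').symm
  | tmul x m => exact h x m
  | add x y hx hy =>
    exact (map_add f (Submodule.Quotient.mk x) (Submodule.Quotient.mk y)).trans
      ((congrArg₂ _ hx hy).trans
        (map_add f' (Submodule.Quotient.mk x) (Submodule.Quotient.mk y)).symm)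

lemma BalancedTensor.tmul_add (x : N) (m m' : M) :
    (BalancedTensor.tmul x (m + m') : BalancedTensor k A N M) =
      BalancedTensor.tmul x m + BalancedTensor.tmul x m' :=
  congrArg Submodule.Quotient.mk (TensorProduct.tmul_add x m m')

end TensorMap

open CategoryTheory

section Functor

variable (k A : Type u) [CommRing k] [Ring A] (N : Type u) [AddCommGroup N] [Module k N]
  [Module Aᵐᵒᵖ N] [SMulCommClass k Aᵐᵒᵖ N]

/-- The functor `N ⊗_A -` from left `A`-modules to `k`-modules. -/
def tensorFunctor : ModuleCat.{u} A ⥤ ModuleCat.{u} k where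
  obj M := ModuleCat.of k (BalancedTensor k A N M)
  map f := ModuleCat.ofHom (BalancedTensor.map (RingHom.id A) LinearMap.id (fun _ _ => rfl) f.hom)
  map_id M := by
    refine ModuleCat.hom_ext (BalancedTensor.hom_ext fun x m => rfl)
  map_comp f g := by
    refine ModuleCat.hom_ext (BalancedTensor.hom_ext fun x m => rfl)

instance : (tensorFunctor k A N).Additive where
  map_add {X Y f g} := by
    refine ModuleCat.hom_ext (BalancedTensor.hom_ext fun x m => ?_)
    exact BalancedTensor.tmul_add x (f.hom m) (g.hom m)

/-- `Tor_j^A(N, M)`: the `j`-th left derived functor of `N ⊗_A -` at `M`. -/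
abbrev Tor (j : ℕ) (M : Type u) [AddCommGroup M] [Module A M] : ModuleCat.{u} k :=
  ((tensorFunctor k A N).leftDerived j).obj (ModuleCat.of A M)

end Functor

section ChangeOfRings

variable {k A B : Type u} [CommRing k] [Ring A] [Ring B] (ρ : A →+* B)
  {N N' : Type u} [AddCommGroup N] [Module k N] [Module Aᵐᵒᵖ N] [SMulCommClass k Aᵐᵒᵖ N]
  [AddCommGroup N'] [Module k N'] [Module Bᵐᵒᵖ N'] [SMulCommClass k Bᵐᵒᵖ N']

/-- The natural map `N ⊗_A X → N' ⊗_B X` for left `B`-modules `X`. -/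
def tensorChange (g : N →ₗ[k] N')
    (hg : ∀ (a : A) (x : N), g (MulOpposite.op a • x) = MulOpposite.op (ρ a) • g x) :
    ModuleCat.restrictScalars ρ ⋙ tensorFunctor k A N ⟶ tensorFunctor k B N' where
  app X := ModuleCat.ofHom (BalancedTensor.map (M := (ModuleCat.restrictScalars ρ).obj X)
    (M' := X) ρ g hg { toFun := fun x => x, map_add' := fun _ _ => rfl,
                       map_smul' := fun _ _ => rfl })
  naturality X Y f := by
    refine ModuleCat.hom_ext (BalancedTensor.hom_ext fun x m => rfl)

end ChangeOfRings

section Lift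

open CategoryTheory.Limits

variable {A B : Type u} [Ring A] [Ring B] (ρ : A →+* B)

/-- `B`-modules regarded as `A`-modules, termwise on complexes. -/
abbrev restrictComplex (K : ChainComplex (ModuleCat.{u} B) ℕ) : ChainComplex (ModuleCat.{u} A) ℕ :=
  ((ModuleCat.restrictScalars ρ).mapHomologicalComplex _).obj K

variable {X : ModuleCat.{u} A} {Y : ModuleCat.{u} B} (f : X ⟶ (ModuleCat.restrictScalars ρ).obj Y)
  (P : ProjectiveResolution X) (Q : ProjectiveResolution Y)

lemma restrict_map_exact {S : ShortComplex (ModuleCat.{u} B)} (h : S.Exact) :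
    (S.map (ModuleCat.restrictScalars ρ)).Exact := by
  rw [ShortComplex.ShortExact.moduleCat_exact_iff_function_exact] at h ⊢
  exact h

instance restrict_epi {Z Z' : ModuleCat.{u} B} (p : Z ⟶ Z') [Epi p] :
    Epi ((ModuleCat.restrictScalars ρ).map p) :=
  (ModuleCat.epi_iff_surjective _).2 ((ModuleCat.epi_iff_surjective p).1 inferInstance)

lemma restrict_exact_succ (n : ℕ) : (ShortComplex.mk _ _
    ((restrictComplex ρ Q.complex).d_comp_d (n + 2) (n + 1) n)).Exact :=
  restrict_map_exact ρ (Q.exact_succ n)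

/-- The augmentation `Q₀ → Y` of a resolution. -/
def augmentation : Q.complex.X 0 ⟶ Y := Q.π.f 0

instance : Epi (augmentation Q) := inferInstanceAs (Epi (Q.π.f 0))

lemma d_augmentation : Q.complex.d 1 0 ≫ augmentation Q = 0 := Q.complex_d_comp_π_f_zero

lemma exact_augmentation : (ShortComplex.mk _ _ (d_augmentation Q)).Exact := Q.exact₀

/-- Degree `0` of `liftRestrict`. -/
def liftRestrictZero : P.complex.X 0 ⟶ (ModuleCat.restrictScalars ρ).obj (Q.complex.X 0) :=
  Projective.factorThru (augmentation P ≫ f) ((ModuleCat.restrictScalars ρ).map (augmentation Q))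

lemma liftRestrictZero_comp : liftRestrictZero ρ f P Q ≫
    (ModuleCat.restrictScalars ρ).map (augmentation Q) = augmentation P ≫ f :=
  Projective.factorThru_comp _ _

lemma liftRestrictZero_aux : (P.complex.d 1 0 ≫ liftRestrictZero ρ f P Q) ≫
    (ModuleCat.restrictScalars ρ).map (augmentation Q) = 0 := by
  rw [Category.assoc, liftRestrictZero_comp, ← Category.assoc, d_augmentation, zero_comp]

/-- Degree `1` of `liftRestrict`. -/
def liftRestrictOne : P.complex.X 1 ⟶ (ModuleCat.restrictScalars ρ).obj (Q.complex.X 1) :=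
  (restrict_map_exact ρ (exact_augmentation Q)).liftFromProjective
    (P.complex.d 1 0 ≫ liftRestrictZero ρ f P Q) (liftRestrictZero_aux ρ f P Q)

lemma liftRestrictOne_comp : liftRestrictOne ρ f P Q ≫
    (ModuleCat.restrictScalars ρ).map (Q.complex.d 1 0) =
    P.complex.d 1 0 ≫ liftRestrictZero ρ f P Q :=
  (restrict_map_exact ρ (exact_augmentation Q)).liftFromProjective_comp _ _

/-- A lift of an `A`-linear map `f : X → Y` to a chain map from a projective resolution of the
`A`-module `X` to a projective resolution of the `B`-module `Y`, regarded as a complex of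
`A`-modules. It is unique up to homotopy. -/
def liftRestrict : P.complex ⟶ restrictComplex ρ Q.complex :=
  ChainComplex.mkHom _ _ (liftRestrictZero ρ f P Q) (liftRestrictOne ρ f P Q)
    (liftRestrictOne_comp ρ f P Q)
    fun n ⟨_, g', w⟩ =>
      ⟨(restrict_exact_succ ρ Q n).liftFromProjective (P.complex.d (n + 2) (n + 1) ≫ g')
        (by
          change (P.complex.d (n + 2) (n + 1) ≫ g') ≫ (restrictComplex ρ Q.complex).d (n + 1) n = 0
          rw [Category.assoc, w, ← Category.assoc, P.complex.d_comp_d, zero_comp]),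
       (restrict_exact_succ ρ Q n).liftFromProjective_comp _ _⟩

lemma liftRestrict_comp : (liftRestrict ρ f P Q).f 0 ≫
    (ModuleCat.restrictScalars ρ).map (augmentation Q) = augmentation P ≫ f := by
  exact liftRestrictZero_comp ρ f P Q

end Lift

section TorMap

variable {k A B : Type u} [CommRing k] [Ring A] [Ring B] (ρ : A →+* B)
  {N N' : Type u} [AddCommGroup N] [Module k N] [Module Aᵐᵒᵖ N] [SMulCommClass k Aᵐᵒᵖ N]
  [AddCommGroup N'] [Module k N'] [Module Bᵐᵒᵖ N'] [SMulCommClass k Bᵐᵒᵖ N']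
  {M M' : Type u} [AddCommGroup M] [Module A M] [AddCommGroup M'] [Module B M']

/-- A map `M → M'` that is semilinear along `ρ`, as an `A`-linear map. -/
def semilinearHom (f : M →ₛₗ[ρ] M') :
    ModuleCat.of A M ⟶ (ModuleCat.restrictScalars ρ).obj (ModuleCat.of B M') :=
  ModuleCat.ofHom (Y := (ModuleCat.restrictScalars ρ).obj (ModuleCat.of B M'))
    { toFun := f, map_add' := map_add f, map_smul' := fun a m => map_smulₛₗ f a m }

/-- The natural map `Tor_j^A(N, M) → Tor_j^B(N', M')` induced by a ring homomorphism `ρ : A → B`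
and maps `g : N → N'` and `f : M → M'` that are semilinear along `ρ`. If `P → M` and `Q → M'` are
projective resolutions over `A` and `B`, and `φ : P → Q` is an `A`-linear chain map lifting `f`,
then it is the map on homology of `g ⊗ φ : N ⊗_A P → N' ⊗_B Q`. -/
def torMap (g : N →ₗ[k] N')
    (hg : ∀ (a : A) (x : N), g (MulOpposite.op a • x) = MulOpposite.op (ρ a) • g x)
    (f : M →ₛₗ[ρ] M') (j : ℕ) : Tor k A N j M →ₗ[k] Tor k B N' j M' :=
  let P := projectiveResolution (ModuleCat.of A M)
  let Q := projectiveResolution (ModuleCat.of B M')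
  let Φ : ((tensorFunctor k A N).mapHomologicalComplex _).obj P.complex ⟶
      ((tensorFunctor k B N').mapHomologicalComplex _).obj Q.complex :=
    ((tensorFunctor k A N).mapHomologicalComplex _).map
        (liftRestrict ρ (semilinearHom ρ f) P Q) ≫
      (NatTrans.mapHomologicalComplex (tensorChange ρ g hg) _).app Q.complex
  ((P.isoLeftDerivedObj (tensorFunctor k A N) j).hom ≫
    HomologicalComplex.homologyMap Φ j ≫
    (Q.isoLeftDerivedObj (tensorFunctor k B N') j).inv).hom

end TorMap

section Statement

variable (k : Type u) [Field k] [CharZero k] (n : ℕ)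

/-- The natural map `ι_j : Tor_j^𝒟(R^τ, M) → Tor_j^𝒟̂(R̂^τ, M̂)` induced by `M → M̂`. -/
def iota (M : Type u) [AddCommGroup M] [Module (D k n) M] (j : ℕ) :
    Tor k (D k n) (Transpose (Poly k n)) j M →ₗ[k]
      Tor k (DHat k n) (Transpose (Series k n)) j (Completion k n M) :=
  torMap (toHat k n) (polyToSeries k n) (fun P => polyToSeries_smul k n (MulOpposite.op P))
    (Completion.kappa k n) j

/-- A grading `M = ⨁ M_l` of the underlying `R`-module of a `𝒟`-module `M` makes it a graded
`𝒟`-module if `∂ᵢ M_l ⊆ M_{l-1}`. -/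
structure IsGradedDModule {M : Type u} [AddCommGroup M] [Module (D k n) M]
    (ℳ : ℤ → AddSubgroup M) : Prop where
  isInternal : DirectSum.IsInternal ℳ
  poly_smul : ∀ (d : ℕ) (l : ℤ) (r : Poly k n) (m : M), r.IsHomogeneous d → m ∈ ℳ l →
    (DiffOp.ofFun r : D k n) • m ∈ ℳ (d + l)
  pd_smul : ∀ (i : Fin n) (l : ℤ) (m : M), m ∈ ℳ l → pd k (Poly k n) i • m ∈ ℳ (l - 1)

end Statement

end

end DMod

/-!
The ring `𝒟` is left Noetherian, since a left ideal is determined by the ideal of its principal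
symbols, so `M` has a resolution by free modules `𝒟^b` of finite rank with homogeneous matrices
as differentials. Since `M̂ = 𝒟̂ ⊗_𝒟 M` and `R̂` is flat over `R`, the same matrices define a
resolution of `M̂` by free `𝒟̂`-modules. Hence `ι_j` is induced on homology by the inclusion
`R^b ⊆ R̂^b` of complexes with the same homogeneous differentials. The first complex is the
direct sum of its graded pieces and the second is the product of the same pieces, so `ι_j` is
the inclusion of the direct sum of their homology spaces `H_l` in the product. It is injective,
and if the direct sum is finite-dimensional, then `H_l = 0` for all but finitely many `l` and it
is bijective.
-/

universe v w

namespace DMod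

noncomputable section

open CategoryTheory CategoryTheory.Limits

open scoped TensorProduct

section Homotopy

variable {C : Type w} [Category.{v} C] [Abelian C] {P K : ChainComplex C ℕ} {Z : C}
  [∀ i, Projective (P.X i)] {π : K.X 0 ⟶ Z} {hπ : K.d 1 0 ≫ π = 0}

/-- The null-homotopy of a chain map from a complex of projectives to a resolution `K` of `Z`
that vanishes after composition with the augmentation `π`. -/
def homotopyZeroOfExact (h₀ : (ShortComplex.mk _ _ hπ).Exact)
    (hK : ∀ n, (ShortComplex.mk _ _ (K.d_comp_d (n + 2) (n + 1) n)).Exact)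
    (f : P ⟶ K) (comm : f.f 0 ≫ π = 0) : Homotopy f 0 :=
  have zero_comp_d : h₀.liftFromProjective (f.f 0) comm ≫ K.d 1 0 = f.f 0 :=
    h₀.liftFromProjective_comp _ _
  have sub_comp_d : (f.f 1 - P.d 1 0 ≫ h₀.liftFromProjective (f.f 0) comm) ≫ K.d 1 0 = 0 := by
    rw [Preadditive.sub_comp, Category.assoc, zero_comp_d, f.comm, sub_self]
  have one_comp_d : (hK 0).liftFromProjective _ sub_comp_d ≫ K.d 2 1 =
      f.f 1 - P.d 1 0 ≫ h₀.liftFromProjective (f.f 0) comm :=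
    (hK 0).liftFromProjective_comp _ _
  Homotopy.mkInductive _ (h₀.liftFromProjective (f.f 0) comm) zero_comp_d.symm
    ((hK 0).liftFromProjective _ sub_comp_d) (add_eq_of_eq_sub' one_comp_d).symm
    fun n ⟨_, g', w⟩ =>
      ⟨(hK (n + 1)).liftFromProjective (f.f (n + 2) - P.d (n + 2) (n + 1) ≫ g') (by
          change _ ≫ K.d (n + 2) (n + 1) = 0
          rw [Preadditive.sub_comp, f.comm, w]
          simp),
      (add_eq_of_eq_sub' ((hK (n + 1)).liftFromProjective_comp _ _)).symm⟩

/-- The homotopy between two chain maps from a complex of projectives to a resolution `K` of `Z`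
that agree after composition with the augmentation `π`. -/
def homotopyOfExact (h₀ : (ShortComplex.mk _ _ hπ).Exact)
    (hK : ∀ n, (ShortComplex.mk _ _ (K.d_comp_d (n + 2) (n + 1) n)).Exact)
    (f g : P ⟶ K) (comm : f.f 0 ≫ π = g.f 0 ≫ π) : Homotopy f g :=
  Homotopy.equivSubZero.invFun (homotopyZeroOfExact h₀ hK (f - g) (by
    rw [HomologicalComplex.sub_f_apply, Preadditive.sub_comp, comm, sub_self]))

end Homotopy

section LeftDerived

variable {C : Type w} [Category.{v} C] [Abelian C] [HasProjectiveResolutions C]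
  {C' : Type*} [Category* C'] [Abelian C'] (F : C ⥤ C') [F.Additive] {X : C}
  {P P' : ProjectiveResolution X} (a : P.complex ⟶ P'.complex)

variable (P) in
/-- The isomorphism `L_j F(X) ≅ H_j(F P)` for a projective resolution `P` of `X`. -/
def leftDerivedIsoHomology (j : ℕ) :
    (F.leftDerived j).obj X ≅ ((F.mapHomologicalComplex _).obj P.complex).homology j :=
  P.isoLeftDerivedObj F j

lemma leftDerivedIsoHomology_hom_comp (ha : a.f 0 ≫ P'.π.f 0 = P.π.f 0) (j : ℕ) :
    (leftDerivedIsoHomology F P j).hom ≫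
        HomologicalComplex.homologyMap ((F.mapHomologicalComplex _).map a) j =
      (leftDerivedIsoHomology F P' j).hom := by
  have h := ProjectiveResolution.isoLeftDerivedObj_hom_naturality (𝟙 X) P P' a
    (ha.trans (Category.comp_id _).symm) F j
  rw [CategoryTheory.Functor.map_id, Category.id_comp] at h
  exact h.symm

lemma comp_leftDerivedIsoHomology_inv (ha : a.f 0 ≫ P'.π.f 0 = P.π.f 0) (j : ℕ) :
    HomologicalComplex.homologyMap ((F.mapHomologicalComplex _).map a) j ≫
        (leftDerivedIsoHomology F P' j).inv =
      (leftDerivedIsoHomology F P j).inv := by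
  rw [Iso.comp_inv_eq, ← leftDerivedIsoHomology_hom_comp F a ha, Iso.inv_hom_id_assoc]

end LeftDerived

section TorMap

variable {k A B : Type u} [CommRing k] [Ring A] [Ring B] (ρ : A →+* B)

/-- The restriction along `ρ` of a chain map of complexes of `B`-modules. -/
abbrev restrictMap {Q Q' : ChainComplex (ModuleCat.{u} B) ℕ} (b : Q ⟶ Q') :
    restrictComplex ρ Q ⟶ restrictComplex ρ Q' :=
  ((ModuleCat.restrictScalars ρ).mapHomologicalComplex _).map b

/-- The augmentation `Q₀ → Y` of a resolution over `B`, as an `A`-linear map. -/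
def restrictAugmentation {Y : ModuleCat.{u} B} (Q : ProjectiveResolution Y) :
    (restrictComplex ρ Q.complex).X 0 ⟶ (ModuleCat.restrictScalars ρ).obj Y :=
  (ModuleCat.restrictScalars ρ).map (augmentation Q)

lemma d_comp_restrictAugmentation {Y : ModuleCat.{u} B} (Q : ProjectiveResolution Y) :
    (restrictComplex ρ Q.complex).d 1 0 ≫ restrictAugmentation ρ Q = 0 :=
  ((ShortComplex.mk _ _ (d_augmentation Q)).map (ModuleCat.restrictScalars ρ)).zero

lemma restrictMap_comp_restrictAugmentation {Y : ModuleCat.{u} B} {Q Q' : ProjectiveResolution Y}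
    (b : Q.complex ⟶ Q'.complex) (hb : b.f 0 ≫ augmentation Q' = augmentation Q) :
    (restrictMap ρ b).f 0 ≫ restrictAugmentation ρ Q' = restrictAugmentation ρ Q := by
  rw [restrictAugmentation, restrictAugmentation, ← hb, Functor.map_comp]
  rfl

/-- The homotopy between two lifts of the same map along resolutions over `A` and `B`. -/
def homotopyOfLifts {P : ChainComplex (ModuleCat.{u} A) ℕ} [∀ i, Projective (P.X i)]
    {Y : ModuleCat.{u} B} {Q : ProjectiveResolution Y} (φ ψ : P ⟶ restrictComplex ρ Q.complex)
    (h : φ.f 0 ≫ restrictAugmentation ρ Q = ψ.f 0 ≫ restrictAugmentation ρ Q) : Homotopy φ ψ :=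
  homotopyOfExact (hπ := d_comp_restrictAugmentation ρ Q)
    (restrict_map_exact ρ (exact_augmentation Q)) (restrict_exact_succ ρ Q) φ ψ h

variable {N N' : Type u} [AddCommGroup N] [Module k N] [Module Aᵐᵒᵖ N] [SMulCommClass k Aᵐᵒᵖ N]
  [AddCommGroup N'] [Module k N'] [Module Bᵐᵒᵖ N'] [SMulCommClass k Bᵐᵒᵖ N']

variable (k N) in
/-- The complex `N ⊗_A P` of `k`-modules, for a complex `P` of left `A`-modules. -/
abbrev tensorComplex (P : ChainComplex (ModuleCat.{u} A) ℕ) : ChainComplex (ModuleCat.{u} k) ℕ :=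
  ((tensorFunctor k A N).mapHomologicalComplex _).obj P

variable (k N) in
/-- The chain map `N ⊗_A P → N ⊗_A P'` induced by a chain map `P → P'`. -/
abbrev tensorComplexMap {P P' : ChainComplex (ModuleCat.{u} A) ℕ} (a : P ⟶ P') :
    tensorComplex k N P ⟶ tensorComplex k N P' :=
  ((tensorFunctor k A N).mapHomologicalComplex _).map a

variable (g : N →ₗ[k] N')
  (hg : ∀ (a : A) (x : N), g (MulOpposite.op a • x) = MulOpposite.op (ρ a) • g x)

/-- The chain map `N ⊗_A Q → N' ⊗_B Q` for a complex `Q` of `B`-modules. -/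
def tensorChangeComplex (Q : ChainComplex (ModuleCat.{u} B) ℕ) :
    tensorComplex k N (restrictComplex ρ Q) ⟶ tensorComplex k N' Q :=
  (NatTrans.mapHomologicalComplex (tensorChange ρ g hg) _).app Q

lemma tensorChangeComplex_naturality {Q Q' : ChainComplex (ModuleCat.{u} B) ℕ} (b : Q ⟶ Q') :
    tensorComplexMap k N (restrictMap ρ b) ≫ tensorChangeComplex ρ g hg Q' =
      tensorChangeComplex ρ g hg Q ≫ tensorComplexMap k N' b :=
  (NatTrans.mapHomologicalComplex (tensorChange ρ g hg) _).naturality b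

/-- The chain map `N ⊗_A P → N' ⊗_B Q` induced by an `A`-linear chain map `P → Q`. -/
def tensorChainMap {P : ChainComplex (ModuleCat.{u} A) ℕ} {Q : ChainComplex (ModuleCat.{u} B) ℕ}
    (φ : P ⟶ restrictComplex ρ Q) : tensorComplex k N P ⟶ tensorComplex k N' Q :=
  tensorComplexMap k N φ ≫ tensorChangeComplex ρ g hg Q

lemma tensorChainMap_comp {P P' : ChainComplex (ModuleCat.{u} A) ℕ}
    {Q Q' : ChainComplex (ModuleCat.{u} B) ℕ} (a : P ⟶ P') (φ : P' ⟶ restrictComplex ρ Q)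
    (b : Q ⟶ Q') :
    tensorChainMap ρ g hg (a ≫ φ ≫ restrictMap ρ b) =
      tensorComplexMap k N a ≫ tensorChainMap ρ g hg φ ≫ tensorComplexMap k N' b := by
  simp only [tensorChainMap, tensorComplexMap, Functor.map_comp, Category.assoc]
  rw [← tensorChangeComplex_naturality]

lemma homologyMap_tensorChainMap_eq {P : ChainComplex (ModuleCat.{u} A) ℕ}
    {Q : ChainComplex (ModuleCat.{u} B) ℕ} {φ ψ : P ⟶ restrictComplex ρ Q} (H : Homotopy φ ψ)
    (j : ℕ) :
    HomologicalComplex.homologyMap (tensorChainMap ρ g hg φ) j =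
      HomologicalComplex.homologyMap (tensorChainMap ρ g hg ψ) j :=
  (((tensorFunctor k A N).mapHomotopy H).compRight
    (tensorChangeComplex ρ g hg Q)).homologyMap_eq j

variable {M M' : Type u} [AddCommGroup M] [Module A M] [AddCommGroup M'] [Module B M']

theorem torMap_eq (f : M →ₛₗ[ρ] M') (P' : ProjectiveResolution (ModuleCat.of A M))
    (Q' : ProjectiveResolution (ModuleCat.of B M'))
    (φ : P'.complex ⟶ restrictComplex ρ Q'.complex)
    (hφ : φ.f 0 ≫ restrictAugmentation ρ Q' = augmentation P' ≫ semilinearHom ρ f) (j : ℕ) :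
    torMap ρ g hg f j = ((leftDerivedIsoHomology (tensorFunctor k A N) P' j).hom ≫
      HomologicalComplex.homologyMap (tensorChainMap ρ g hg φ) j ≫
      (leftDerivedIsoHomology (tensorFunctor k B N') Q' j).inv).hom := by
  let P := projectiveResolution (ModuleCat.of A M)
  let Q := projectiveResolution (ModuleCat.of B M')
  let a : P.complex ⟶ P'.complex := ProjectiveResolution.lift (𝟙 _) P P'
  let b : Q'.complex ⟶ Q.complex := ProjectiveResolution.lift (𝟙 _) Q' Q
  have ha : a.f 0 ≫ augmentation P' = augmentation P :=
    (ProjectiveResolution.lift_commutes_zero _ _ _).trans (Category.comp_id _)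
  have hb : b.f 0 ≫ augmentation Q = augmentation Q' :=
    (ProjectiveResolution.lift_commutes_zero _ _ _).trans (Category.comp_id _)
  let ψ := liftRestrict ρ (semilinearHom ρ f) P Q
  have hψ : ψ.f 0 ≫ restrictAugmentation ρ Q = augmentation P ≫ semilinearHom ρ f :=
    liftRestrict_comp _ _ _ _
  have H : Homotopy ψ (a ≫ φ ≫ restrictMap ρ b) := homotopyOfLifts ρ _ _ (by
    rw [hψ, HomologicalComplex.comp_f, HomologicalComplex.comp_f, Category.assoc, Category.assoc,
      restrictMap_comp_restrictAugmentation ρ b hb, hφ, ← ha, Category.assoc])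
  change ((leftDerivedIsoHomology (tensorFunctor k A N) P j).hom ≫
    HomologicalComplex.homologyMap (tensorChainMap ρ g hg ψ) j ≫
    (leftDerivedIsoHomology (tensorFunctor k B N') Q j).inv).hom = _
  rw [homologyMap_tensorChainMap_eq ρ g hg H, tensorChainMap_comp,
    HomologicalComplex.homologyMap_comp, HomologicalComplex.homologyMap_comp, Category.assoc,
    Category.assoc, comp_leftDerivedIsoHomology_inv _ b hb,
    ← leftDerivedIsoHomology_hom_comp _ a ha, Category.assoc]

section Iff

variable {f : M →ₛₗ[ρ] M'} {P : ProjectiveResolution (ModuleCat.of A M)}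
  {Q : ProjectiveResolution (ModuleCat.of B M')} {φ : P.complex ⟶ restrictComplex ρ Q.complex}
  (hφ : φ.f 0 ≫ restrictAugmentation ρ Q = augmentation P ≫ semilinearHom ρ f) (j : ℕ)

include hφ

theorem torMap_injective_iff : Function.Injective (torMap ρ g hg f j) ↔
    Function.Injective (HomologicalComplex.homologyMap (tensorChainMap ρ g hg φ) j) := by
  rw [torMap_eq ρ g hg f P Q φ hφ]
  exact (EquivLike.comp_injective _ (leftDerivedIsoHomology _ Q j).symm.toLinearEquiv).trans
    (EquivLike.injective_comp (leftDerivedIsoHomology _ P j).toLinearEquiv _)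

theorem torMap_surjective_iff : Function.Surjective (torMap ρ g hg f j) ↔
    Function.Surjective (HomologicalComplex.homologyMap (tensorChainMap ρ g hg φ) j) := by
  rw [torMap_eq ρ g hg f P Q φ hφ]
  exact (EquivLike.comp_surjective _ (leftDerivedIsoHomology _ Q j).symm.toLinearEquiv).trans
    (EquivLike.surjective_comp (leftDerivedIsoHomology _ P j).toLinearEquiv _)

end Iff

end TorMap

section Homology

variable {k : Type u} [CommRing k] {ι : Type*} {c : ComplexShape ι}
  {K L : HomologicalComplex (ModuleCat.{u} k) c} {j : ι}

lemma homologyπ_surjective : Function.Surjective (K.homologyπ j) :=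
  (ModuleCat.epi_iff_surjective (K.homologyπ j)).1 inferInstance

lemma iCycles_injective : Function.Injective (K.iCycles j) :=
  (ModuleCat.mono_iff_injective (K.iCycles j)).1 inferInstance

lemma homologyMap_homologyπ (φ : K ⟶ L) (z : K.cycles j) :
    HomologicalComplex.homologyMap φ j (K.homologyπ j z) =
      L.homologyπ j (HomologicalComplex.cyclesMap φ j z) :=
  congrArg (fun f => f.hom z) (HomologicalComplex.homologyπ_naturality φ j)

lemma iCycles_cyclesMap (φ : K ⟶ L) (z : K.cycles j) :
    L.iCycles j (HomologicalComplex.cyclesMap φ j z) = φ.f j (K.iCycles j z) :=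
  congrArg (fun f => f.hom z) (HomologicalComplex.cyclesMap_i φ j)

lemma hom_f_d (φ : K ⟶ L) (i i' : ι) (x : K.X i) :
    φ.f i' (K.d i i' x) = L.d i i' (φ.f i x) :=
  congrArg (fun f => f.hom x) (φ.comm i i').symm

lemma homologyπ_eq_zero_iff {z : K.cycles j} :
    K.homologyπ j z = 0 ↔ ∃ y, K.d (c.prev j) j y = K.iCycles j z := by
  have toCycles_i (y : K.X (c.prev j)) :
      K.iCycles j (K.toCycles (c.prev j) j y) = K.d (c.prev j) j y :=
    congrArg (fun f => f.hom y) (K.toCycles_i (c.prev j) j)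
  have exact : (ShortComplex.mk _ _ (K.toCycles_comp_homologyπ (c.prev j) j)).Exact :=
    ShortComplex.exact_of_g_is_cokernel _ (K.homologyIsCokernel (c.prev j) j rfl)
  rw [ShortComplex.ShortExact.moduleCat_exact_iff_function_exact] at exact
  refine (exact z).trans (exists_congr fun y => ?_)
  rw [← toCycles_i, iCycles_injective.eq_iff]

end Homology

section GradedCompletion

variable {k : Type u} {I : Type*}

/-- A linear map `g : N → N'` that identifies `N` with a direct sum of submodules indexed by `I` and
`N'` with their product. The composite of the `l`-th projection `N' → N_l` with the inclusion
`N_l → N` is `p l`. -/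
structure IsGradedCompletion [CommRing k] {N N' : Type*} [AddCommGroup N] [Module k N]
    [AddCommGroup N'] [Module k N'] (g : N →ₗ[k] N') (p : I → (N' →ₗ[k] N)) : Prop where
  exists_sum_eq : ∀ x, ∃ s : Finset I, ∑ l ∈ s, p l (g x) = x
  proj_self : ∀ l y, p l (g (p l y)) = p l y
  proj_of_ne : ∀ l m y, l ≠ m → p l (g (p m y)) = 0
  exists_proj_eq : ∀ x : I → N, ∃ y, ∀ l, p l y = p l (g (x l))
  eq_zero_of_proj : ∀ y, (∀ l, p l y = 0) → y = 0

namespace IsGradedCompletion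

section Module

variable [CommRing k] {N N' : Type*} [AddCommGroup N] [Module k N] [AddCommGroup N'] [Module k N']
  {g : N →ₗ[k] N'}

lemma exists_forall_sum_eq {p : I → (N' →ₗ[k] N)} (h : IsGradedCompletion g p) (x : N) :
    ∃ s : Finset I, ∀ t, s ⊆ t → ∑ l ∈ t, p l (g x) = x := by
  obtain ⟨s, hs⟩ := h.exists_sum_eq x
  refine ⟨s, fun t hst => (Finset.sum_subset hst fun l _ hl => ?_).symm.trans hs⟩
  rw [← hs, map_sum, map_sum]
  exact Finset.sum_eq_zero fun m hm => h.proj_of_ne l m _ fun hlm => hl (hlm ▸ hm)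

lemma comp_equiv {J : Type*} {p : I → (N' →ₗ[k] N)} (h : IsGradedCompletion g p) (σ : J ≃ I) :
    IsGradedCompletion g (fun l => p (σ l)) where
  exists_sum_eq x := by
    obtain ⟨s, hs⟩ := h.exists_sum_eq x
    exact ⟨s.map σ.symm.toEmbedding, by simpa using hs⟩
  proj_self l := h.proj_self (σ l)
  proj_of_ne l m y hlm := h.proj_of_ne (σ l) (σ m) y (σ.injective.ne hlm)
  exists_proj_eq x := by
    obtain ⟨y, hy⟩ := h.exists_proj_eq fun l => x (σ.symm l)
    exact ⟨y, fun l => by rw [hy, σ.symm_apply_apply]⟩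
  eq_zero_of_proj y hy := h.eq_zero_of_proj y (σ.forall_congr_right.1 hy)

lemma of_coordinates {ι : Type*} [Finite ι] {p : ι → I → (N' →ₗ[k] N)}
    (h : ∀ i, IsGradedCompletion g (p i)) {K K' : Type*} [AddCommGroup K] [Module k K]
    [AddCommGroup K'] [Module k K'] (e : K ≃ₗ[k] (ι → N)) (e' : K' ≃ₗ[k] (ι → N'))
    {κ : K →ₗ[k] K'} {π : I → (K' →ₗ[k] K)} (hκ : ∀ x i, e' (κ x) i = g (e x i))
    (hπ : ∀ l y i, e (π l y) i = p i l (e' y i)) : IsGradedCompletion κ π where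
  exists_sum_eq x := by
    classical
    have := Fintype.ofFinite ι
    choose s hs using fun i => (h i).exists_forall_sum_eq (e x i)
    refine ⟨Finset.univ.biUnion s, e.injective (funext fun i => ?_)⟩
    rw [map_sum, Finset.sum_apply]
    simp only [hπ, hκ]
    exact hs i _ (Finset.subset_biUnion_of_mem s (Finset.mem_univ i))
  proj_self l y := e.injective (funext fun i => by rw [hπ, hκ, hπ, (h i).proj_self])
  proj_of_ne l m y hlm := e.injective (funext fun i => by
    rw [hπ, hκ, hπ, (h i).proj_of_ne l m _ hlm, map_zero, Pi.zero_apply])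
  exists_proj_eq x := by
    choose y hy using fun i => (h i).exists_proj_eq fun l => e (x l) i
    exact ⟨e'.symm y, fun l => e.injective (funext fun i => by
      rw [hπ, hπ, hκ, e'.apply_symm_apply, hy])⟩
  eq_zero_of_proj y hy := e'.injective (funext fun i => by
    rw [map_zero, Pi.zero_apply]
    exact (h i).eq_zero_of_proj _ fun l => by rw [← hπ, hy, map_zero, Pi.zero_apply])

end Module

section Complex

variable {ι : Type*} {c : ComplexShape ι}

section CommRing

variable [CommRing k] {K L : HomologicalComplex (ModuleCat.{u} k) c} {κ : K ⟶ L} {π : I → (L ⟶ K)}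
  (h : ∀ j, IsGradedCompletion (κ.f j).hom (fun l => ((π l).f j).hom))

include h

lemma homologyMap_proj [DecidableEq I] (l m : I) (j : ι) (a : L.homology j) :
    HomologicalComplex.homologyMap (π l) j (HomologicalComplex.homologyMap κ j
        (HomologicalComplex.homologyMap (π m) j a)) =
      if l = m then HomologicalComplex.homologyMap (π m) j a else 0 := by
  have comp : HomologicalComplex.homologyMap (π m ≫ κ ≫ π l) j a =
      HomologicalComplex.homologyMap (π l) j (HomologicalComplex.homologyMap κ j
        (HomologicalComplex.homologyMap (π m) j a)) := by
    simp [HomologicalComplex.homologyMap_comp]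
  rw [← comp]
  split_ifs with hlm
  · have proj_self : π m ≫ κ ≫ π m = π m := by
      ext j y
      exact (h j).proj_self m y
    rw [hlm, proj_self]
  · have proj_of_ne : π m ≫ κ ≫ π l = 0 := by
      ext j y
      exact (h j).proj_of_ne l m y hlm
    rw [proj_of_ne, HomologicalComplex.homologyMap_zero]
    rfl

lemma exists_sum_homologyMap_eq (j : ι) (a : K.homology j) :
    ∃ s : Finset I, ∑ l ∈ s, HomologicalComplex.homologyMap (π l) j
      (HomologicalComplex.homologyMap κ j a) = a := by
  obtain ⟨z, rfl⟩ := homologyπ_surjective a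
  obtain ⟨s, hs⟩ := (h j).exists_sum_eq (K.iCycles j z)
  refine ⟨s, ?_⟩
  simp only [homologyMap_homologyπ, ← map_sum]
  refine congrArg _ (iCycles_injective ?_)
  simpa only [map_sum, iCycles_cyclesMap] using hs

lemma eq_zero_of_homologyMap_proj {j : ι} {a : L.homology j}
    (ha : ∀ l, HomologicalComplex.homologyMap (π l) j a = 0) : a = 0 := by
  obtain ⟨z, rfl⟩ := homologyπ_surjective a
  simp only [homologyMap_homologyπ, homologyπ_eq_zero_iff, iCycles_cyclesMap] at ha
  choose y hy using ha
  obtain ⟨Y, hY⟩ := (h (c.prev j)).exists_proj_eq y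
  refine homologyπ_eq_zero_iff.2 ⟨Y, ?_⟩
  refine sub_eq_zero.1 ((h j).eq_zero_of_proj _ fun l => ?_)
  have hdY : (π l).f j (L.d _ j Y) = (π l).f j (L.iCycles j z) := by
    rw [hom_f_d]
    refine (congrArg _ (hY l)).trans ?_
    change K.d _ j ((π l).f _ (κ.f _ (y l))) = _
    rw [← hom_f_d, ← hom_f_d, hy]
    exact (h j).proj_self l _
  exact (map_sub _ _ _).trans (sub_eq_zero.2 hdY)

theorem homologyMap_injective (j : ι) :
    Function.Injective (HomologicalComplex.homologyMap κ j) := by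
  refine (injective_iff_map_eq_zero (HomologicalComplex.homologyMap κ j).hom).2 fun a ha => ?_
  obtain ⟨s, hs⟩ := exists_sum_homologyMap_eq h j a
  rw [← hs]
  exact Finset.sum_eq_zero fun l _ => (congrArg _ ha).trans (map_zero _)

end CommRing

variable [Field k] {K L : HomologicalComplex (ModuleCat.{u} k) c} {κ : K ⟶ L} {π : I → (L ⟶ K)}
  (h : ∀ j, IsGradedCompletion (κ.f j).hom (fun l => ((π l).f j).hom))

include h

lemma finite_homologyMap_proj_ne_zero {j : ι} [FiniteDimensional k (K.homology j)]
    (a : L.homology j) :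
    {l | HomologicalComplex.homologyMap (π l) j a ≠ 0}.Finite := by
  classical
  let S := {l | HomologicalComplex.homologyMap (π l) j a ≠ 0}
  have independent :
      LinearIndependent k fun l : S => HomologicalComplex.homologyMap (π l) j a := by
    refine linearIndependent_iff'.2 fun s g hsum i hi => ?_
    have hi_sum := congrArg (fun b => HomologicalComplex.homologyMap (π i) j
      (HomologicalComplex.homologyMap κ j b)) hsum
    simp only [map_sum, map_smul, map_zero, homologyMap_proj h, Subtype.coe_inj, smul_ite,
      smul_zero, Finset.sum_ite_eq, if_pos hi] at hi_sum
    exact (smul_eq_zero.1 hi_sum).resolve_right i.2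
  exact Set.finite_coe_iff.1 independent.finite

theorem homologyMap_surjective (j : ι) [FiniteDimensional k (K.homology j)] :
    Function.Surjective (HomologicalComplex.homologyMap κ j) := by
  classical
  intro a
  have hS := finite_homologyMap_proj_ne_zero h a
  refine ⟨∑ l ∈ hS.toFinset, HomologicalComplex.homologyMap (π l) j a, ?_⟩
  refine sub_eq_zero.1 (eq_zero_of_homologyMap_proj h fun m => ?_)
  simp only [map_sub, map_sum, homologyMap_proj h, Finset.sum_ite_eq, Set.Finite.mem_toFinset,
    Set.mem_ofPred_eq, ite_not]
  split_ifs with hm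
  · rw [hm, sub_zero]
  · exact sub_self _

end Complex

end IsGradedCompletion

end GradedCompletion

section Resolution

variable {A : Type u} [Ring A] {X : ℕ → Type u} [∀ j, AddCommGroup (X j)] [∀ j, Module A (X j)]
  (d : ∀ j, X (j + 1) →ₗ[A] X j) (hd : ∀ j, Function.Exact (d (j + 1)) (d j))

/-- The chain complex of an exact sequence of linear maps. -/
def exactComplex : ChainComplex (ModuleCat.{u} A) ℕ :=
  ChainComplex.of (fun j => ModuleCat.of A (X j)) (fun j => ModuleCat.ofHom (d j))
    fun j => ModuleCat.hom_ext (hd j).linearMap_comp_eq_zero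

lemma exactComplex_d (j : ℕ) : (exactComplex d hd).d (j + 1) j = ModuleCat.ofHom (d j) :=
  ChainComplex.of_d (fun j => ModuleCat.of A (X j)) (fun j => ModuleCat.ofHom (d j)) j

lemma exactComplex_exactAt (j : ℕ) : (exactComplex d hd).ExactAt (j + 1) := by
  rw [HomologicalComplex.exactAt_iff' _ (j + 2) (j + 1) j (by simp) (by simp),
    ShortComplex.ShortExact.moduleCat_exact_iff_function_exact]
  change Function.Exact ((exactComplex d hd).d (j + 2) (j + 1)) ((exactComplex d hd).d (j + 1) j)
  rw [exactComplex_d, exactComplex_d]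
  exact hd j

variable {M : Type u} [AddCommGroup M] [Module A M] (ε : X 0 →ₗ[A] M)
  (hε : Function.Exact (d 0) ε)

include hε in
lemma exactComplex_d_comp :
    (exactComplex d hd).d 1 0 ≫ (ModuleCat.ofHom ε : (exactComplex d hd).X 0 ⟶ ModuleCat.of A M) =
      0 := by
  rw [exactComplex_d]
  exact ModuleCat.hom_ext hε.linearMap_comp_eq_zero

/-- The augmentation `ε : X 0 → M` of an exact sequence, as a map of complexes to `M` in
degree `0`. -/
def exactComplexToSingle :
    exactComplex d hd ⟶ (ChainComplex.single₀ (ModuleCat A)).obj (ModuleCat.of A M) :=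
  (ChainComplex.toSingle₀Equiv _ _).symm ⟨ModuleCat.ofHom ε, exactComplex_d_comp d hd ε hε⟩

lemma exactComplexToSingle_f_zero :
    (exactComplexToSingle d hd ε hε).f 0 = ModuleCat.ofHom ε :=
  ChainComplex.toSingle₀Equiv_symm_apply_f_zero _ (exactComplex_d_comp d hd ε hε)

variable (hs : Function.Surjective ε)

include hs in
lemma quasiIsoAt_zero_exactComplexToSingle : QuasiIsoAt (exactComplexToSingle d hd ε hε) 0 := by
  rw [ChainComplex.quasiIsoAt₀_iff, ShortComplex.quasiIso_iff_of_zeros' _ rfl rfl rfl]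
  refine (ShortComplex.exact_and_epi_g_iff_of_iso (S₂ :=
    ShortComplex.mk _ _ (exactComplex_d_comp d hd ε hε)) ?_).2 ⟨?_, ?_⟩
  · refine ShortComplex.isoMk (Iso.refl _) (Iso.refl _) (Iso.refl _)
      ((Category.id_comp _).trans (Category.comp_id _).symm) ?_
    exact (Category.id_comp _).trans
      ((exactComplexToSingle_f_zero d hd ε hε).symm.trans (Category.comp_id _).symm)
  · rw [ShortComplex.ShortExact.moduleCat_exact_iff_function_exact]
    change Function.Exact ((exactComplex d hd).d 1 0) ε
    rw [exactComplex_d]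
    exact hε
  · exact (ModuleCat.epi_iff_surjective _).2 hs

include hs in
lemma quasiIso_exactComplexToSingle : QuasiIso (exactComplexToSingle d hd ε hε) where
  quasiIsoAt
    | 0 => quasiIsoAt_zero_exactComplexToSingle d hd ε hε hs
    | j + 1 => (quasiIsoAt_iff_exactAt' _ _ (ChainComplex.exactAt_succ_single_obj _ _)).2
        (exactComplex_exactAt d hd j)

variable [∀ j, Module.Projective A (X j)]

/-- The projective resolution given by an exact sequence of projective modules. -/
def exactResolution : ProjectiveResolution (ModuleCat.of A M) where
  complex := exactComplex d hd
  projective j := (IsProjective.iff_projective (R := A) (X j)).1 inferInstance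
  π := exactComplexToSingle d hd ε hε
  quasiIso := quasiIso_exactComplexToSingle d hd ε hε hs

lemma augmentation_exactResolution (x : X 0) :
    augmentation (exactResolution d hd ε hε hs) x = ε x :=
  congrArg (fun f => f.hom x) (exactComplexToSingle_f_zero d hd ε hε)

end Resolution

section FreeTensor

variable {k A : Type u} [CommRing k] [Ring A] {N : Type u} [AddCommGroup N] [Module k N]
  [Module Aᵐᵒᵖ N]

section

variable {M : Type u} [AddCommGroup M] [Module A M]

lemma BalancedTensor.smul_tmul (x : N) (a : A) (m : M) :
    (BalancedTensor.tmul (MulOpposite.op a • x) m : BalancedTensor k A N M) =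
      BalancedTensor.tmul x (a • m) :=
  (Submodule.Quotient.eq _).2 (Submodule.subset_span ⟨x, a, m, rfl⟩)

lemma BalancedTensor.add_tmul (x y : N) (m : M) :
    (BalancedTensor.tmul (x + y) m : BalancedTensor k A N M) =
      BalancedTensor.tmul x m + BalancedTensor.tmul y m :=
  congrArg Submodule.Quotient.mk (TensorProduct.add_tmul x y m)

end

variable [SMulCommClass k Aᵐᵒᵖ N]

variable (k A N) in
/-- The map `N → N ⊗_A M`, `x ↦ x ⊗ m`. -/
def BalancedTensor.mkLeft {M : Type u} [AddCommGroup M] [Module A M] (m : M) :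
    N →ₗ[k] BalancedTensor k A N M where
  toFun x := BalancedTensor.tmul x m
  map_add' x y := BalancedTensor.add_tmul x y m
  map_smul' _ _ := rfl

lemma BalancedTensor.tmul_sum {M : Type u} [AddCommGroup M] [Module A M] {ι : Type*}
    (s : Finset ι) (x : N) (m : ι → M) :
    (BalancedTensor.tmul x (∑ i ∈ s, m i) : BalancedTensor k A N M) =
      ∑ i ∈ s, BalancedTensor.tmul x (m i) :=
  map_sum (AddMonoidHom.mk' (fun m : M => (BalancedTensor.tmul x m : BalancedTensor k A N M))
    (BalancedTensor.tmul_add x)) m s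

variable (k) in
/-- The map `N ⊗_A A^ι → N^ι`, `x ⊗ a ↦ (x aᵢ)ᵢ`. -/
def freeTensorHom (ι : Type) : BalancedTensor k A N (ι → A) →ₗ[k] (ι → N) :=
  (balancedRel k A N (ι → A)).liftQ
    (TensorProduct.AlgebraTensorModule.lift
      { toFun := fun x =>
          { toFun := fun a i => MulOpposite.op (a i) • x
            map_add' := fun a a' => funext fun i => by simp [add_smul]
            map_smul' := fun c a => funext fun i => by
              change MulOpposite.op (c • a i) • x = c • MulOpposite.op (a i) • x
              rw [MulOpposite.op_smul, smul_assoc] }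
        map_add' := fun x x' => LinearMap.ext fun a => funext fun i => by simp
        map_smul' := fun c x => LinearMap.ext fun a => funext fun i => by
          simp [smul_comm] })
    (by
      refine Submodule.span_le.2 ?_
      rintro _ ⟨x, a, m, rfl⟩
      rw [SetLike.mem_coe, LinearMap.mem_ker, map_sub, sub_eq_zero]
      funext i
      simp [mul_smul])

variable (k A N) in
/-- The isomorphism `N ⊗_A A^ι ≃ N^ι`. -/
def freeTensorEquiv (ι : Type) [Fintype ι] [DecidableEq ι] :
    BalancedTensor k A N (ι → A) ≃ₗ[k] (ι → N) :=
  LinearEquiv.ofLinearMap (freeTensorHom k ι)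
    (∑ i, (BalancedTensor.mkLeft k A N (Pi.single i (1 : A))).comp (LinearMap.proj i))
    (LinearMap.ext fun x => funext fun i => by
      rw [LinearMap.comp_apply, LinearMap.sum_apply, map_sum, Finset.sum_apply]
      change ∑ j, MulOpposite.op ((Pi.single j (1 : A) : ι → A) i) • x j = x i
      simp [Pi.single_apply, ite_smul, apply_ite MulOpposite.op])
    (BalancedTensor.hom_ext fun x a => by
      rw [LinearMap.comp_apply, LinearMap.sum_apply]
      change ∑ i, BalancedTensor.tmul (MulOpposite.op (a i) • x) (Pi.single i (1 : A)) =
        BalancedTensor.tmul x a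
      simp only [BalancedTensor.smul_tmul]
      rw [← BalancedTensor.tmul_sum, ← pi_eq_sum_univ' a])

lemma freeTensorEquiv_map {ι κ : Type} [Fintype ι] [DecidableEq ι] [Fintype κ] [DecidableEq κ]
    (v : ι → κ → A) (z : BalancedTensor k A N (ι → A)) (j : κ) :
    freeTensorEquiv k A N κ (BalancedTensor.map (RingHom.id A) LinearMap.id (fun _ _ => rfl)
      (Fintype.linearCombination A v) z) j =
      ∑ i, MulOpposite.op (v i j) • freeTensorEquiv k A N ι z i := by
  have := SMulCommClass.symm k Aᵐᵒᵖ N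
  let F : BalancedTensor k A N (ι → A) →ₗ[k] N :=
    LinearMap.proj j ∘ₗ (freeTensorEquiv k A N κ).toLinearMap ∘ₗ
      BalancedTensor.map (RingHom.id A) LinearMap.id (fun _ _ => rfl)
        (Fintype.linearCombination A v)
  let G : BalancedTensor k A N (ι → A) →ₗ[k] N :=
    ∑ i, Module.toModuleEnd k N (MulOpposite.op (v i j)) ∘ₗ LinearMap.proj i ∘ₗ
      (freeTensorEquiv k A N ι).toLinearMap
  have : F = G := BalancedTensor.hom_ext fun x a => by
    simp only [G, LinearMap.sum_apply]
    change MulOpposite.op ((Fintype.linearCombination A v a) j) • x =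
      ∑ i, MulOpposite.op (v i j) • MulOpposite.op (a i) • x
    simp [Fintype.linearCombination_apply, Finset.sum_apply, Finset.op_sum, Finset.sum_smul,
      mul_smul]
  refine (LinearMap.congr_fun this z).trans ?_
  simp only [G, LinearMap.sum_apply]
  rfl

end FreeTensor

section Grading

variable {ι N N' : Type*} [AddCommGroup N] [AddCommGroup N']

lemma range_coeAddMonoidHom [DecidableEq ι] (𝒩 : ι → AddSubgroup N) :
    (DirectSum.coeAddMonoidHom 𝒩).range = ⨆ l, 𝒩 l := by
  refine le_antisymm ?_ (iSup_le fun l y hy =>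
    ⟨DirectSum.of _ l ⟨y, hy⟩, DirectSum.coeAddMonoidHom_of _ _ _⟩)
  rintro _ ⟨x, rfl⟩
  induction x using DirectSum.induction_on with
  | zero => rw [map_zero]; exact zero_mem _
  | of l y => rw [DirectSum.coeAddMonoidHom_of]; exact AddSubgroup.mem_iSup_of_mem l y.2
  | add x y hx hy => rw [map_add]; exact add_mem hx hy

lemma isInternal_addSubgroup_iff [DecidableEq ι] {𝒩 : ι → AddSubgroup N} :
    DirectSum.IsInternal 𝒩 ↔ iSupIndep 𝒩 ∧ ⨆ l, 𝒩 l = ⊤ := by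
  rw [← range_coeAddMonoidHom, AddMonoidHom.range_eq_top]
  exact ⟨fun h => ⟨h.addSubgroup_iSupIndep, h.2⟩,
    fun h => ⟨h.1.dfinsuppSumAddHom_injective, h.2⟩⟩

lemma ker_inf_iSup_le {𝒩' : ι → AddSubgroup N'} {𝒩 : ι → AddSubgroup N} (h𝒩 : iSupIndep 𝒩)
    {f : N' →+ N} (hf : ∀ l, 𝒩' l ≤ (𝒩 l).comap f) :
    f.ker ⊓ ⨆ l, 𝒩' l ≤ ⨆ l, 𝒩' l ⊓ f.ker := by
  classical
  rintro a ⟨ha, hsum⟩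
  rw [← range_coeAddMonoidHom] at hsum
  obtain ⟨x, rfl⟩ := hsum
  let fl : ∀ l, 𝒩' l →+ 𝒩 l := fun l =>
    (f.comp (𝒩' l).subtype).codRestrict (𝒩 l) fun y => hf l y.2
  have hcomm : (DirectSum.coeAddMonoidHom 𝒩).comp (DirectSum.map fl) =
      f.comp (DirectSum.coeAddMonoidHom 𝒩') := by
    ext l y
    change DirectSum.coeAddMonoidHom 𝒩 (DirectSum.map fl (DirectSum.of _ l y)) =
      f (DirectSum.coeAddMonoidHom 𝒩' (DirectSum.of _ l y))
    rw [DirectSum.map_of, DirectSum.coeAddMonoidHom_of, DirectSum.coeAddMonoidHom_of]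
    rfl
  have hx : DirectSum.map fl x = 0 := by
    refine h𝒩.dfinsuppSumAddHom_injective ?_
    exact (DFunLike.congr_fun hcomm x).trans (ha.trans (map_zero _).symm)
  rw [DirectSum.coeAddMonoidHom_eq_dfinsuppSum]
  refine sum_mem fun l _ => AddSubgroup.mem_iSup_of_mem l ⟨(x l).2, ?_⟩
  exact congrArg Subtype.val (DFunLike.congr_fun hx l)

lemma exists_homogeneous_generators {A : Type*} [Ring A] [Module A N] {𝒩 : ι → AddSubgroup N}
    {K : Submodule A N} (hK : K.FG)
    (hhom : K.toAddSubgroup ≤ ⨆ l, 𝒩 l ⊓ K.toAddSubgroup) :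
    ∃ (b : ℕ) (deg : Fin b → ι) (v : Fin b → N), (∀ i, v i ∈ 𝒩 (deg i)) ∧
      LinearMap.range (Fintype.linearCombination A v) = K := by
  let S : Set N := {a | a ∈ K ∧ ∃ l, a ∈ 𝒩 l}
  have hle : ⨆ l, 𝒩 l ⊓ K.toAddSubgroup ≤ (Submodule.span A S).toAddSubgroup :=
    iSup_le fun l a ha => Submodule.subset_span ⟨ha.2, l, ha.1⟩
  have hspan : Submodule.span A S = K :=
    le_antisymm (Submodule.span_le.2 fun a ha => ha.1) (hhom.trans hle)
  obtain ⟨t, htS, ht⟩ := (Submodule.fg_span_iff_fg_span_finset_subset S).1 (hspan ▸ hK)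
  choose deg hdeg using fun i => (htS (t.equivFin.symm i).2).2
  refine ⟨t.card, deg, fun i => t.equivFin.symm i, hdeg, ?_⟩
  have hrange : Set.range (fun i => (t.equivFin.symm i : N)) = t :=
    (t.equivFin.symm.surjective.range_comp Subtype.val).trans Subtype.range_coe
  rw [Fintype.range_linearCombination, ← hspan, ht, hrange]

end Grading

section GradedFree

variable {Γ A : Type*} [AddGroup Γ] [Ring A] (𝒜 : Γ → AddSubgroup A) {b : ℕ}

/-- The grading of the free module `A^b` over a graded ring whose `i`-th basis vector has degree
`deg i`. -/
def freeGrade (deg : Fin b → Γ) (l : Γ) : AddSubgroup (Fin b → A) where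
  carrier := {v | ∀ i, v i ∈ 𝒜 (l - deg i)}
  zero_mem' _ := zero_mem _
  add_mem' hv hw i := add_mem (hv i) (hw i)
  neg_mem' hv i := neg_mem (hv i)

variable {𝒜}

lemma iSupIndep_freeGrade (h𝒜 : iSupIndep 𝒜) (deg : Fin b → Γ) :
    iSupIndep (freeGrade 𝒜 deg) := by
  refine fun l => AddSubgroup.disjoint_def.2 fun {v} hv hv' => funext fun i => ?_
  have hle : ⨆ j, ⨆ (_ : j ≠ l), freeGrade 𝒜 deg j ≤
      (⨆ j, ⨆ (_ : j ≠ l - deg i), 𝒜 j).comap (Pi.evalAddMonoidHom (fun _ => A) i) :=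
    iSup₂_le fun j hj w hw => AddSubgroup.mem_iSup_of_mem (j - deg i)
      (AddSubgroup.mem_iSup_of_mem (sub_left_injective.ne hj) (hw i))
  exact AddSubgroup.disjoint_def.1 (h𝒜 (l - deg i)) (hv i) (hle hv')

lemma iSup_freeGrade (h𝒜 : ⨆ e, 𝒜 e = ⊤) (deg : Fin b → Γ) : ⨆ l, freeGrade 𝒜 deg l = ⊤ := by
  refine eq_top_iff.2 fun v _ => ?_
  rw [← Finset.univ_sum_single v]
  refine sum_mem fun i _ => ?_
  have hle : ⨆ e, 𝒜 e ≤
      (⨆ l, freeGrade 𝒜 deg l).comap (AddMonoidHom.single (fun _ => A) i) := by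
    refine iSup_le fun e a ha => AddSubgroup.mem_iSup_of_mem (e + deg i) fun j => ?_
    obtain rfl | h := eq_or_ne j i
    · simpa using ha
    · simp [h]
  exact hle (h𝒜 ▸ AddSubgroup.mem_top (v i))

instance gradedSMul_freeGrade [SetLike.GradedMul 𝒜] (deg : Fin b → Γ) :
    SetLike.GradedSMul 𝒜 (freeGrade 𝒜 deg) where
  smul_mem {e l a v} ha hv i := by
    rw [vadd_eq_add, add_sub_assoc]
    exact SetLike.mul_mem_graded ha (hv i)

variable {N : Type*} [AddCommGroup N] [Module A N] {𝒩 : Γ → AddSubgroup N}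

lemma linearCombination_mem [SetLike.GradedSMul 𝒜 𝒩] {deg : Fin b → Γ} {v : Fin b → N}
    (hv : ∀ i, v i ∈ 𝒩 (deg i)) {l : Γ} {a : Fin b → A} (ha : a ∈ freeGrade 𝒜 deg l) :
    Fintype.linearCombination A v a ∈ 𝒩 l := by
  rw [Fintype.linearCombination_apply]
  refine sum_mem fun i _ => ?_
  have := SetLike.GradedSMul.smul_mem (ha i) (hv i)
  rwa [vadd_eq_add, sub_add_cancel] at this

lemma ker_linearCombination_le [SetLike.GradedSMul 𝒜 𝒩]
    (h𝒜 : ⨆ e, 𝒜 e = ⊤) (h𝒩 : iSupIndep 𝒩) {deg : Fin b → Γ} {v : Fin b → N}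
    (hv : ∀ i, v i ∈ 𝒩 (deg i)) :
    (LinearMap.ker (Fintype.linearCombination A v)).toAddSubgroup ≤
      ⨆ l, freeGrade 𝒜 deg l ⊓ (LinearMap.ker (Fintype.linearCombination A v)).toAddSubgroup := by
  have := ker_inf_iSup_le h𝒩 (𝒩' := freeGrade 𝒜 deg)
    (f := (Fintype.linearCombination A v).toAddMonoidHom) fun l a ha => linearCombination_mem hv ha
  rwa [iSup_freeGrade h𝒜, inf_top_eq] at this

end GradedFree

section GradedResolution

variable {Γ A : Type*} [AddGroup Γ] [Ring A]

/-- A matrix over a graded ring, seen as the linear map `A^rows → A^cols` given by right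
multiplication, that is homogeneous of degree `0` for the given degrees of the basis vectors. -/
structure HomogeneousMatrix (𝒜 : Γ → AddSubgroup A) where
  rows : ℕ
  cols : ℕ
  rowDeg : Fin rows → Γ
  colDeg : Fin cols → Γ
  entry : Fin rows → Fin cols → A
  homogeneous : ∀ i, entry i ∈ freeGrade 𝒜 colDeg (rowDeg i)

namespace HomogeneousMatrix

variable {𝒜 : Γ → AddSubgroup A}

/-- The linear map `A^rows → A^cols` given by a matrix. -/
abbrev linearMap (s : HomogeneousMatrix 𝒜) : (Fin s.rows → A) →ₗ[A] (Fin s.cols → A) :=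
  Fintype.linearCombination A s.entry

variable [DecidableEq Γ] [SetLike.GradedMul 𝒜] [IsNoetherianRing A]

lemma exists_range_eq_ker (h𝒜 : DirectSum.IsInternal 𝒜) (s : HomogeneousMatrix 𝒜) :
    ∃ (b : ℕ) (deg : Fin b → Γ) (v : Fin b → Fin s.rows → A),
      (∀ i, v i ∈ freeGrade 𝒜 s.rowDeg (deg i)) ∧
      LinearMap.range (Fintype.linearCombination A v) = LinearMap.ker s.linearMap :=
  have ⟨hindep, htop⟩ := isInternal_addSubgroup_iff.1 h𝒜
  exists_homogeneous_generators (IsNoetherian.noetherian _)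
    (ker_linearCombination_le htop (iSupIndep_freeGrade hindep s.colDeg) s.homogeneous)

/-- A homogeneous matrix whose rows generate the relations between the rows of a given one. -/
def syzygy (h𝒜 : DirectSum.IsInternal 𝒜) (s : HomogeneousMatrix 𝒜) : HomogeneousMatrix 𝒜 where
  rows := (s.exists_range_eq_ker h𝒜).choose
  cols := s.rows
  rowDeg := (s.exists_range_eq_ker h𝒜).choose_spec.choose
  colDeg := s.rowDeg
  entry := (s.exists_range_eq_ker h𝒜).choose_spec.choose_spec.choose
  homogeneous := (s.exists_range_eq_ker h𝒜).choose_spec.choose_spec.choose_spec.1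

lemma exact_syzygy (h𝒜 : DirectSum.IsInternal 𝒜) (s : HomogeneousMatrix 𝒜) :
    Function.Exact (s.syzygy h𝒜).linearMap s.linearMap :=
  LinearMap.exact_iff.2 (s.exists_range_eq_ker h𝒜).choose_spec.choose_spec.choose_spec.2.symm

end HomogeneousMatrix

variable [DecidableEq Γ] [IsNoetherianRing A]

theorem exists_graded_resolution {𝒜 : Γ → AddSubgroup A} [SetLike.GradedMul 𝒜]
    (h𝒜 : DirectSum.IsInternal 𝒜) {M : Type*} [AddCommGroup M] [Module A M] [Module.Finite A M]
    {ℳ : Γ → AddSubgroup M} [SetLike.GradedSMul 𝒜 ℳ] (hℳ : DirectSum.IsInternal ℳ) :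
    ∃ (b : ℕ → ℕ) (deg : ∀ j, Fin (b j) → Γ) (v : ∀ j, Fin (b (j + 1)) → Fin (b j) → A)
      (w : Fin (b 0) → M),
      (∀ j i, v j i ∈ freeGrade 𝒜 (deg j) (deg (j + 1) i)) ∧
      (∀ j, Function.Exact (Fintype.linearCombination A (v (j + 1)))
        (Fintype.linearCombination A (v j))) ∧
      Function.Exact (Fintype.linearCombination A (v 0)) (Fintype.linearCombination A w) ∧
      Function.Surjective (Fintype.linearCombination A w) := by
  obtain ⟨hindep, htop⟩ := isInternal_addSubgroup_iff.1 hℳ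
  obtain ⟨b₀, deg₀, w, hw, hrange_w⟩ := exists_homogeneous_generators (𝒩 := ℳ)
    (Module.Finite.fg_top (R := A) (M := M)) (by simp [htop])
  obtain ⟨b₁, deg₁, v₀, hv₀, hrange_v₀⟩ := exists_homogeneous_generators
    (IsNoetherian.noetherian _)
    (ker_linearCombination_le (isInternal_addSubgroup_iff.1 h𝒜).2 hindep hw)
  let s : ℕ → HomogeneousMatrix 𝒜 := fun j =>
    Nat.rec ⟨b₁, b₀, deg₁, deg₀, v₀, hv₀⟩ (fun _ t => t.syzygy h𝒜) j
  exact ⟨fun j => (s j).cols, fun j => (s j).colDeg, fun j => (s j).entry, w,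
    fun j => (s j).homogeneous, fun j => (s j).exact_syzygy h𝒜,
    LinearMap.exact_iff.2 hrange_v₀.symm, LinearMap.range_eq_top.1 hrange_w⟩

end GradedResolution

section Components

variable (k : Type u) [Field k] (n : ℕ)

lemma finite_degree_eq (l : ℤ) : {d : Fin n →₀ ℕ | (d.degree : ℤ) = l}.Finite :=
  (Finsupp.finite_of_degree_le l.toNat).subset fun d hd => by
    simp only [Set.mem_ofPred_eq] at hd ⊢; omega

/-- The homogeneous component of degree `l` of a power series; it vanishes for `l < 0`. -/
def hcomp (l : ℤ) : Series k n →ₗ[k] Poly k n :=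
  MvPowerSeries.truncFinset k (finite_degree_eq n l).toFinset

variable {k n}

lemma coeff_hcomp (l : ℤ) (s : Series k n) (d : Fin n →₀ ℕ) :
    (hcomp k n l s).coeff d = if (d.degree : ℤ) = l then MvPowerSeries.coeff d s else 0 := by
  rw [hcomp, MvPowerSeries.coeff_truncFinset]
  simp

lemma hcomp_mul {r : Poly k n} {d : ℕ} (hr : r.IsHomogeneous d) (l : ℤ) (s : Series k n) :
    hcomp k n (l + d) ((r : Series k n) * s) = r * hcomp k n l s := by
  ext m
  rw [coeff_hcomp, MvPowerSeries.coeff_mul, MvPolynomial.coeff_mul, Finset.ite_sum_zero]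
  refine Finset.sum_congr rfl fun p hp => ?_
  rw [coeff_hcomp, MvPolynomial.coeff_coe, mul_ite, mul_zero]
  by_cases hd : p.1.degree = d
  · have hm : m.degree = d + p.2.degree := by
      rw [← Finset.HasAntidiagonal.mem_antidiagonal.1 hp, map_add, hd]
    have hiff : (m.degree : ℤ) = l + d ↔ (p.2.degree : ℤ) = l := by omega
    simp only [hiff]
  · simp [hr.coeff_eq_zero hd]

lemma hcomp_pderiv (i : Fin n) (l : ℤ) (s : Series k n) :
    hcomp k n (l + (-1)) (MvPowerSeries.pderiv k i s) = MvPolynomial.pderiv i (hcomp k n l s) := by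
  ext m
  have hiff : (m.degree : ℤ) = l + (-1) ↔ ((m + Finsupp.single i 1).degree : ℤ) = l := by
    rw [map_add, Finsupp.degree_single]
    omega
  simp only [coeff_hcomp, MvPowerSeries.coeff_pderiv, MvPolynomial.coeff_pderiv, ite_mul,
    zero_mul, hiff]

lemma hcomp_hcomp (l l' : ℤ) (s : Series k n) :
    hcomp k n l (hcomp k n l' s : Poly k n) = if l = l' then hcomp k n l s else 0 := by
  ext m
  rw [coeff_hcomp, MvPolynomial.coeff_coe, coeff_hcomp]
  split_ifs with h₁ h₂ h₃
  · rw [coeff_hcomp, if_pos h₁]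
  · exact absurd (h₁.symm.trans h₂) h₃
  · exact absurd (h₁.trans ‹l = l'›) h₂
  · rfl
  · rw [coeff_hcomp, if_neg h₁]
  · rfl

lemma hcomp_ext {s : Series k n} (h : ∀ l, hcomp k n l s = 0) : s = 0 := by
  ext m
  have := congrArg (MvPolynomial.coeff m) (h m.degree)
  rwa [coeff_hcomp, if_pos rfl] at this

lemma exists_hcomp_eq (r : ℤ → Series k n) : ∃ s, ∀ l, hcomp k n l s = hcomp k n l (r l) := by
  let s : Series k n := fun d => MvPowerSeries.coeff d (r d.degree)
  have hs : ∀ d, MvPowerSeries.coeff d s = MvPowerSeries.coeff d (r d.degree) := fun d => rfl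
  refine ⟨s, fun l => MvPolynomial.ext _ _ fun m => ?_⟩
  rw [coeff_hcomp, coeff_hcomp, hs]
  exact ite_congr rfl (fun h => by rw [h]) fun _ => rfl

lemma sum_hcomp (r : Poly k n) {t : Finset ℤ} (ht : ∀ d ∈ r.support, (d.degree : ℤ) ∈ t) :
    ∑ l ∈ t, hcomp k n l (r : Series k n) = r := by
  ext m
  rw [MvPolynomial.coeff_sum]
  simp only [coeff_hcomp, MvPolynomial.coeff_coe, Finset.sum_ite_eq, ite_eq_left_iff]
  exact fun h => (MvPolynomial.notMem_support_iff.1 (mt (ht m) h)).symm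

end Components

section NormalForm

variable {k : Type u} [Field k] {n : ℕ} {A : Type u} [CommRing A] [Algebra k A] [Coordinates k A n]

lemma pdPow_zero : pdPow k A 0 = 1 := dpow_zero

lemma pdPow_single_add (i : Fin n) (α : Fin n →₀ ℕ) :
    pdPow k A (Finsupp.single i 1 + α) = pd k A i * pdPow k A α := by
  rw [pdPow, pdPow, dpow_add, dpow_single]

lemma finsupp_induction_single {p : (Fin n →₀ ℕ) → Prop} (zero : p 0)
    (single_add : ∀ i α, p α → p (Finsupp.single i 1 + α)) (α : Fin n →₀ ℕ) : p α := by
  induction hs : α.degree generalizing α with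
  | zero =>
    obtain rfl := (Finsupp.degree_eq_zero_iff α).1 hs
    exact zero
  | succ s ih =>
    have hα : α ≠ 0 := by rintro rfl; simp at hs
    obtain ⟨i, hi⟩ := Finsupp.ne_iff.1 hα
    obtain ⟨γ, rfl⟩ := exists_add_of_le (Finsupp.single_le_iff.2 (Nat.one_le_iff_ne_zero.2 hi))
    rw [map_add, Finsupp.degree_single] at hs
    exact single_add i γ (ih γ (by omega))

variable [CharZero k]

lemma diffOp_induction {p : DiffOp k A → Prop} (zero : p 0) (add : ∀ P Q, p P → p Q → p (P + Q))
    (normal : ∀ (a : A) α, p (DiffOp.ofFun a * pdPow k A α)) (P : DiffOp k A) : p P := by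
  obtain ⟨f, rfl⟩ := normalEquiv.surjective P
  induction f using Finsupp.induction_linear with
  | zero => rw [map_zero]; exact zero
  | add f g hf hg => rw [map_add]; exact add _ _ hf hg
  | single α a => rw [normalEquiv_single]; exact normal a α

variable {N : Type*} [AddCommGroup N]

/-- The additive map `∑ a_α ∂ ^ α ↦ ∑ f_α(a_α)`. -/
def normalHom (f : (Fin n →₀ ℕ) → A →+ N) : DiffOp k A →+ N :=
  (Finsupp.liftAddHom f).comp normalEquiv.symm.toAddMonoidHom

lemma normalHom_apply (f : (Fin n →₀ ℕ) → A →+ N) (a : A) (α : Fin n →₀ ℕ) :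
    normalHom f (DiffOp.ofFun a * pdPow k A α) = f α a := by
  rw [← normalEquiv_single]
  simp [normalHom]

end NormalForm

section GradedOperators

variable {k : Type u} [Field k] {n : ℕ}

variable (k n) in
/-- The operators that are homogeneous of degree `e`: sums of operators `r ∂ ^ α` with `r`
homogeneous of degree `e + |α|`. -/
def gradeD (e : ℤ) : AddSubgroup (D k n) :=
  AddSubgroup.closure {P | ∃ (r : Poly k n) (α : Fin n →₀ ℕ) (d : ℕ), r.IsHomogeneous d ∧
    (d : ℤ) - α.degree = e ∧ P = DiffOp.ofFun r * pdPow k (Poly k n) α}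

lemma gradeD_induction {q : ℤ → D k n → Prop} {e : ℤ} {P : D k n} (hP : P ∈ gradeD k n e)
    (zero : ∀ e, q e 0)
    (ofFun : ∀ (r : Poly k n) (d : ℕ), r.IsHomogeneous d → q d (DiffOp.ofFun r))
    (pd : ∀ i, q (-1) (pd k (Poly k n) i))
    (add : ∀ e P Q, q e P → q e Q → q e (P + Q))
    (mul : ∀ e e' P Q, q e P → q e' Q → q (e + e') (P * Q)) : q e P := by
  have hpow : ∀ α : Fin n →₀ ℕ, q (-(α.degree : ℤ)) (pdPow k (Poly k n) α) := by
    intro α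
    induction α using finsupp_induction_single with
    | zero => simpa [pdPow_zero] using ofFun 1 0 (MvPolynomial.isHomogeneous_one _ _)
    | single_add i α ih =>
      rw [pdPow_single_add, map_add, Finsupp.degree_single, Nat.cast_add, neg_add, Nat.cast_one]
      exact mul _ _ _ _ (pd i) ih
  induction hP using AddSubgroup.closure_induction with
  | mem P hP =>
    obtain ⟨r, α, d, hd, rfl, rfl⟩ := hP
    rw [sub_eq_add_neg]
    exact mul _ _ _ _ (ofFun r d hd) (hpow α)
  | zero => exact zero _
  | add P Q _ _ hP hQ => exact add _ _ _ hP hQ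
  | neg P _ hP =>
    simpa using mul _ _ _ _ (ofFun (-1) 0 (MvPolynomial.isHomogeneous_one _ _).neg) hP

lemma eq_zero_of_smul_hcomp {P : D k n} (hP : ∀ l (s : Series k n), P • hcomp k n l s = 0) :
    P = 0 := by
  refine DiffOp.ext (LinearMap.ext fun r => ?_)
  change P • r = 0
  rw [← sum_hcomp r (t := r.support.image fun d => (d.degree : ℤ))
    (fun d hd => Finset.mem_image_of_mem _ hd), Finset.smul_sum]
  exact Finset.sum_eq_zero fun l _ => hP l r

lemma IsGradedDModule.gradedSMul {M : Type u} [AddCommGroup M] [Module (D k n) M]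
    {ℳ : ℤ → AddSubgroup M} (h : IsGradedDModule k n ℳ) :
    SetLike.GradedSMul (gradeD k n) ℳ where
  smul_mem {e l P m} hP hm := by
    rw [vadd_eq_add]
    refine gradeD_induction (q := fun e P => ∀ l, ∀ m ∈ ℳ l, P • m ∈ ℳ (e + l)) hP
      (fun e l m _ => ?_) (fun r d hr l m hm => h.poly_smul d l r m hr hm)
      (fun i l m hm => ?_) (fun e P Q hP hQ l m hm => ?_) (fun e e' P Q hP hQ l m hm => ?_) l m hm
    · rw [zero_smul]; exact zero_mem _
    · rw [neg_add_eq_sub]; exact h.pd_smul i l m hm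
    · rw [add_smul]; exact add_mem (hP l m hm) (hQ l m hm)
    · rw [mul_smul, add_assoc]; exact hP _ _ (hQ l m hm)

variable [CharZero k]

lemma iSup_gradeD : ⨆ e, gradeD k n e = ⊤ := by
  refine eq_top_iff.2 fun P _ => ?_
  induction P using diffOp_induction with
  | zero => exact zero_mem _
  | add P Q hP hQ => exact add_mem (hP trivial) (hQ trivial)
  | normal a α =>
    rw [← MvPolynomial.sum_homogeneousComponent a, map_sum, Finset.sum_mul]
    exact sum_mem fun d _ => AddSubgroup.mem_iSup_of_mem ((d : ℤ) - α.degree)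
      (AddSubgroup.subset_closure
        ⟨_, α, d, MvPolynomial.homogeneousComponent_isHomogeneous d a, rfl, rfl⟩)

lemma toHat_ofFun (r : Poly k n) : toHat k n (DiffOp.ofFun r) = DiffOp.ofFun (r : Series k n) :=
  DiffOp.lift_ofFun _ _ _ _ r

lemma toHat_pd (i : Fin n) : toHat k n (pd k (Poly k n) i) = pd k (Series k n) i :=
  DiffOp.lift_pd _ _ _ _ i

variable (k n) in
/-- The operators that shift homogeneous components of power series by `e`. This is another
description of `gradeD`, from which the independence and the multiplicativity of the grading are
clear. -/
def shiftD (e : ℤ) : AddSubgroup (D k n) where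
  carrier := {P | ∀ (l : ℤ) (s : Series k n),
    hcomp k n (l + e) (toHat k n P • s) = P • hcomp k n l s}
  zero_mem' l s := by simp
  add_mem' hP hQ l s := by
    rw [map_add, add_smul, map_add, hP, hQ, add_smul]
  neg_mem' hP l s := by
    rw [map_neg, neg_smul, map_neg, hP, neg_smul]

lemma mul_mem_shiftD {e e' : ℤ} {P Q : D k n} (hP : P ∈ shiftD k n e) (hQ : Q ∈ shiftD k n e') :
    P * Q ∈ shiftD k n (e + e') := by
  intro l s
  rw [map_mul, mul_smul, mul_smul, ← hQ l s, ← hP, add_comm e, add_assoc]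

lemma gradeD_le_shiftD (e : ℤ) : gradeD k n e ≤ shiftD k n e := fun P hP => by
  refine gradeD_induction (q := fun e P => P ∈ shiftD k n e) hP (fun _ => zero_mem _)
    (fun r d hr l s => ?_) (fun i l s => ?_) (fun _ _ _ hP hQ => add_mem hP hQ)
    fun _ _ _ _ hP hQ => mul_mem_shiftD hP hQ
  · rw [toHat_ofFun]
    exact hcomp_mul hr l s
  · rw [toHat_pd]
    exact hcomp_pderiv i l s

lemma hcomp_toHat_smul_hcomp_eq_zero {e : ℤ} {P : D k n}
    (hP : P ∈ ⨆ e', ⨆ (_ : e' ≠ e), shiftD k n e') (l : ℤ) (s : Series k n) :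
    hcomp k n (l + e) (toHat k n P • (hcomp k n l s : Series k n)) = 0 := by
  let T : AddSubgroup (D k n) := (((hcomp k n (l + e)).toAddMonoidHom.comp
    (AddMonoidHom.flip (AddMonoidHom.smul) (hcomp k n l s : Series k n))).comp
      (toHat k n).toAddMonoidHom).ker
  suffices ⨆ e', ⨆ (_ : e' ≠ e), shiftD k n e' ≤ T from this hP
  refine iSup₂_le fun e' he' Q hQ => ?_
  change hcomp k n (l + e) (toHat k n Q • (hcomp k n l s : Series k n)) = 0
  have hshift := hQ (l + e - e') (hcomp k n l s)
  rwa [sub_add_cancel, hcomp_hcomp, if_neg (by omega), smul_zero] at hshift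

lemma iSupIndep_shiftD : iSupIndep (shiftD k n) := by
  refine fun e => AddSubgroup.disjoint_def.2 fun {P} hP hP' => eq_zero_of_smul_hcomp fun l s => ?_
  have hshift := hP l (hcomp k n l s)
  rwa [hcomp_toHat_smul_hcomp_eq_zero hP', hcomp_hcomp, if_pos rfl, eq_comm] at hshift

lemma gradeD_eq_shiftD : gradeD k n = shiftD k n :=
  (iSupIndep_shiftD.le_iff_eq_of_iSup_eq_top iSup_gradeD).1 gradeD_le_shiftD

lemma isInternal_gradeD : DirectSum.IsInternal (gradeD k n) :=
  isInternal_addSubgroup_iff.2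
    ⟨by simpa only [gradeD_eq_shiftD] using iSupIndep_shiftD, iSup_gradeD⟩

instance gradedMul_gradeD : SetLike.GradedMul (gradeD k n) where
  mul_mem _ _ _ _ hP hQ := by
    rw [gradeD_eq_shiftD] at hP hQ ⊢
    exact mul_mem_shiftD hP hQ

variable (k n) in
/-- `hcomp` as a map `R̂^τ → R^τ`. -/
def hcompT (l : ℤ) : Transpose (Series k n) →ₗ[k] Transpose (Poly k n) := hcomp k n l

section

variable {A : Type u} [CommRing A] [Algebra k A] [Coordinates k A n]

lemma op_ofFun_smul (r : A) (s : Transpose A) :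
    MulOpposite.op (DiffOp.ofFun r : DiffOp k A) • s = (r * (show A from s) : A) := by
  have htau : tau (DiffOp.ofFun r : DiffOp k A) = MulOpposite.op (DiffOp.ofFun r) :=
    DiffOp.lift_ofFun _ _ _ _ r
  change (tau (DiffOp.ofFun r : DiffOp k A)).unop.toEnd s = _
  rw [htau]
  rfl

lemma op_pd_smul (i : Fin n) (s : Transpose A) :
    MulOpposite.op (pd k A i) • s = (-(pd k A i).toEnd s : A) := by
  have htau : tau (pd k A i) = MulOpposite.op (-pd k A i) := DiffOp.lift_pd _ _ _ _ i
  change (tau (pd k A i)).unop.toEnd s = _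
  rw [htau]
  rfl

end

lemma hcompT_op_smul {e : ℤ} {P : D k n} (hP : P ∈ gradeD k n e) (l : ℤ)
    (s : Transpose (Series k n)) :
    hcompT k n (l + e) (MulOpposite.op (toHat k n P) • s) = MulOpposite.op P • hcompT k n l s := by
  refine gradeD_induction (q := fun e P => ∀ l (s : Transpose (Series k n)),
    hcompT k n (l + e) (MulOpposite.op (toHat k n P) • s) = MulOpposite.op P • hcompT k n l s) hP
    (fun e l s => ?_) (fun r d hr l s => ?_) (fun i l s => ?_) (fun e P Q hP hQ l s => ?_)
    (fun e e' P Q hP hQ l s => ?_) l s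
  · rw [map_zero, MulOpposite.op_zero, MulOpposite.op_zero, zero_smul, zero_smul, map_zero]
  · rw [toHat_ofFun, op_ofFun_smul, op_ofFun_smul]
    exact hcomp_mul hr l s
  · rw [toHat_pd, op_pd_smul, op_pd_smul]
    exact (map_neg (hcomp k n (l + -1)) _).trans (congrArg _ (hcomp_pderiv i l s))
  · rw [map_add, MulOpposite.op_add, MulOpposite.op_add, add_smul, add_smul, map_add, hP, hQ]
  · rw [map_mul, MulOpposite.op_mul, MulOpposite.op_mul, mul_smul, mul_smul, ← hP, ← hQ,
      add_assoc]

end GradedOperators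

section Noetherian

variable {σ R : Type*} [CommSemiring R]

lemma homogeneousComponent_succ_X_mul (i : σ) (g : MvPolynomial σ R) (m : ℕ) :
    MvPolynomial.homogeneousComponent (m + 1) (MvPolynomial.X i * g) =
      MvPolynomial.X i * MvPolynomial.homogeneousComponent m g := by
  classical
  ext β
  rw [MvPolynomial.coeff_homogeneousComponent, MvPolynomial.coeff_X_mul',
    MvPolynomial.coeff_X_mul', MvPolynomial.coeff_homogeneousComponent]
  by_cases hi : i ∈ β.support
  · obtain ⟨γ, rfl⟩ := exists_add_of_le (Finsupp.single_le_iff.2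
      (Nat.one_le_iff_ne_zero.2 (Finsupp.mem_support_iff.1 hi)))
    rw [if_pos hi, if_pos hi, add_tsub_cancel_left, map_add, Finsupp.degree_single]
    exact if_congr (by omega) rfl rfl
  · rw [if_neg hi, if_neg hi, ite_self]

variable {k : Type u} [Field k] [CharZero k] {n : ℕ} {A : Type u} [CommRing A] [Algebra k A]
  [Coordinates k A n]

/-- The full symbol `∑ f_α ∂ ^ α ↦ ∑ f_α ξ ^ α`. -/
def symbol : DiffOp k A →+ MvPolynomial (Fin n) A :=
  normalHom fun α => (MvPolynomial.monomial α).toAddMonoidHom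

lemma symbol_normal (a : A) (α : Fin n →₀ ℕ) :
    symbol (DiffOp.ofFun a * pdPow k A α) = MvPolynomial.monomial α a :=
  normalHom_apply _ a α

lemma coeff_symbol (P : DiffOp k A) (α : Fin n →₀ ℕ) :
    (symbol P).coeff α = normalEquiv.symm P α := by
  classical
  induction P using diffOp_induction with
  | zero => rw [map_zero, map_zero]; rfl
  | add P Q hP hQ => rw [map_add, map_add, MvPolynomial.coeff_add, Finsupp.add_apply, hP, hQ]
  | normal a β =>
    rw [symbol_normal, ← normalEquiv_single, AddEquiv.symm_apply_apply,
      MvPolynomial.coeff_monomial, Finsupp.single_apply]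

lemma symbol_injective : Function.Injective (symbol : DiffOp k A → MvPolynomial (Fin n) A) :=
  fun P Q h => normalEquiv.symm.injective <| Finsupp.ext fun α => by
    rw [← coeff_symbol, h, coeff_symbol]

lemma symbol_ofFun_mul (r : A) (P : DiffOp k A) :
    symbol (DiffOp.ofFun r * P) = MvPolynomial.C r * symbol P := by
  induction P using diffOp_induction with
  | zero => rw [mul_zero, map_zero, mul_zero]
  | add P Q hP hQ => rw [mul_add, map_add, map_add, mul_add, hP, hQ]
  | normal a α =>
    rw [← mul_assoc, ← map_mul, symbol_normal, symbol_normal, MvPolynomial.C_mul_monomial]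

lemma coeff_symbol_pd_mul (i : Fin n) (P : DiffOp k A) (β : Fin n →₀ ℕ) :
    (symbol (pd k A i * P)).coeff β =
      (MvPolynomial.X i * symbol P).coeff β + Coordinates.der (k := k) i ((symbol P).coeff β) := by
  classical
  induction P using diffOp_induction with
  | zero => rw [mul_zero, map_zero, mul_zero, MvPolynomial.coeff_zero, map_zero, add_zero]
  | add P Q hP hQ =>
    rw [mul_add, map_add, map_add, mul_add, MvPolynomial.coeff_add, MvPolynomial.coeff_add,
      MvPolynomial.coeff_add, map_add, hP, hQ, add_add_add_comm]
  | normal a α =>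
    rw [← mul_assoc, pd_mul_ofFun, add_mul, mul_assoc, ← pdPow_single_add, map_add, symbol_normal,
      symbol_normal, symbol_normal, MvPolynomial.coeff_add, MvPolynomial.X,
      MvPolynomial.monomial_mul, one_mul, MvPolynomial.coeff_monomial β α,
      MvPolynomial.coeff_monomial β α, apply_ite (Coordinates.der (k := k) (A := A) i), map_zero]

/-- `P` has order at most `m`, and its principal symbol in degree `m` is the homogeneous component
of `g` of degree `m`. -/
def HasPrincipalSymbol (m : ℕ) (P : DiffOp k A) (g : MvPolynomial (Fin n) A) : Prop :=
  ∀ β : Fin n →₀ ℕ, m ≤ β.degree →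
    (symbol P).coeff β = (MvPolynomial.homogeneousComponent m g).coeff β

namespace HasPrincipalSymbol

variable {m : ℕ} {P Q : DiffOp k A} {g h : MvPolynomial (Fin n) A}

lemma add (hP : HasPrincipalSymbol m P g) (hQ : HasPrincipalSymbol m Q h) :
    HasPrincipalSymbol m (P + Q) (g + h) := fun β hβ => by
  rw [map_add, map_add, MvPolynomial.coeff_add, MvPolynomial.coeff_add, hP β hβ, hQ β hβ]

lemma ofFun_mul (hP : HasPrincipalSymbol m P g) (r : A) :
    HasPrincipalSymbol m (DiffOp.ofFun r * P) (MvPolynomial.C r * g) := fun β hβ => by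
  rw [symbol_ofFun_mul, MvPolynomial.homogeneousComponent_C_mul, MvPolynomial.coeff_C_mul,
    MvPolynomial.coeff_C_mul, hP β hβ]

lemma pd_mul (hP : HasPrincipalSymbol m P g) (i : Fin n) :
    HasPrincipalSymbol (m + 1) (pd k A i * P) (MvPolynomial.X i * g) := fun β hβ => by
  classical
  rw [coeff_symbol_pd_mul, hP β (by omega), MvPolynomial.coeff_homogeneousComponent,
    if_neg (by omega), map_zero, add_zero, homogeneousComponent_succ_X_mul,
    MvPolynomial.coeff_X_mul', MvPolynomial.coeff_X_mul']
  split_ifs with hi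
  · obtain ⟨γ, rfl⟩ := exists_add_of_le (Finsupp.single_le_iff.2
      (Nat.one_le_iff_ne_zero.2 (Finsupp.mem_support_iff.1 hi)))
    rw [map_add, Finsupp.degree_single] at hβ
    rw [add_tsub_cancel_left]
    exact hP γ (by omega)
  · rfl

lemma coeff_symbol_sub (hP : HasPrincipalSymbol m P g) (hQ : HasPrincipalSymbol m Q g)
    {β : Fin n →₀ ℕ} (hβ : m ≤ β.degree) : (symbol (P - Q)).coeff β = 0 := by
  rw [map_sub, MvPolynomial.coeff_sub, hP β hβ, hQ β hβ, sub_self]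

lemma homogeneousComponent_symbol
    (hP : ∀ β : Fin n →₀ ℕ, m + 1 ≤ β.degree → (symbol P).coeff β = 0) :
    HasPrincipalSymbol m P (MvPolynomial.homogeneousComponent m (symbol P)) := fun β hβ => by
  rw [MvPolynomial.homogeneousComponent_of_mem (MvPolynomial.homogeneousComponent_mem m _),
    if_pos rfl, MvPolynomial.coeff_homogeneousComponent]
  split_ifs
  · rfl
  · exact hP β (by omega)

end HasPrincipalSymbol

/-- The polynomials all of whose homogeneous components are principal symbols of operators in the
left ideal `I`. -/
def symbolIdeal (I : Submodule (DiffOp k A) (DiffOp k A)) : Ideal (MvPolynomial (Fin n) A) where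
  carrier := {g | ∀ m, ∃ P ∈ I, HasPrincipalSymbol m P g}
  zero_mem' m := ⟨0, zero_mem I, fun β _ => by rw [map_zero, map_zero]⟩
  add_mem' hg hh m := by
    obtain ⟨P, hPI, hP⟩ := hg m
    obtain ⟨Q, hQI, hQ⟩ := hh m
    exact ⟨P + Q, add_mem hPI hQI, hP.add hQ⟩
  smul_mem' a g hg := by
    rw [smul_eq_mul]
    induction a using MvPolynomial.induction_on generalizing g with
    | C r =>
      intro m
      obtain ⟨P, hPI, hP⟩ := hg m
      exact ⟨DiffOp.ofFun r * P, I.smul_mem _ hPI, hP.ofFun_mul r⟩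
    | add p q hp hq =>
      intro m
      obtain ⟨P, hPI, hP⟩ := hp g hg m
      obtain ⟨Q, hQI, hQ⟩ := hq g hg m
      exact ⟨P + Q, add_mem hPI hQI, add_mul p q g ▸ hP.add hQ⟩
    | mul_X p i hp =>
      rw [mul_assoc]
      refine hp _ fun m => ?_
      cases m with
      | zero =>
        refine ⟨0, zero_mem I, fun β _ => ?_⟩
        rw [MvPolynomial.homogeneousComponent_zero, MvPolynomial.coeff_X_mul', if_neg (by simp),
          map_zero, map_zero]
      | succ m =>
        obtain ⟨P, hPI, hP⟩ := hg m
        exact ⟨pd k A i * P, I.smul_mem _ hPI, hP.pd_mul i⟩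

lemma symbolIdeal_mono {I J : Submodule (DiffOp k A) (DiffOp k A)} (h : I ≤ J) :
    symbolIdeal I ≤ symbolIdeal J := fun _ hg m =>
  let ⟨P, hPI, hP⟩ := hg m
  ⟨P, h hPI, hP⟩

lemma homogeneousComponent_symbol_mem_symbolIdeal {I : Submodule (DiffOp k A) (DiffOp k A)}
    {m : ℕ} {P : DiffOp k A} (hPI : P ∈ I)
    (hP : ∀ β : Fin n →₀ ℕ, m + 1 ≤ β.degree → (symbol P).coeff β = 0) :
    MvPolynomial.homogeneousComponent m (symbol P) ∈ symbolIdeal I := fun m' => by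
  rcases eq_or_ne m' m with rfl | hm
  · exact ⟨P, hPI, .homogeneousComponent_symbol hP⟩
  · refine ⟨0, zero_mem I, fun β _ => ?_⟩
    rw [map_zero, MvPolynomial.homogeneousComponent_of_mem
      (MvPolynomial.homogeneousComponent_mem m _), if_neg hm]

lemma le_of_symbolIdeal_le {I J : Submodule (DiffOp k A) (DiffOp k A)} (hIJ : I ≤ J)
    (h : symbolIdeal J ≤ symbolIdeal I) : J ≤ I := by
  suffices ∀ m, ∀ P ∈ J, (∀ β : Fin n →₀ ℕ, m ≤ β.degree → (symbol P).coeff β = 0) → P ∈ I from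
    fun P hP => this ((symbol P).totalDegree + 1) P hP fun β hβ =>
      MvPolynomial.coeff_eq_zero_of_totalDegree_lt hβ
  intro m
  induction m with
  | zero =>
    intro P _ hP
    obtain rfl : P = 0 := symbol_injective <| MvPolynomial.ext _ _ fun β => by
      rw [hP β (Nat.zero_le _), map_zero, MvPolynomial.coeff_zero]
    exact zero_mem I
  | succ m ih =>
    intro P hPJ hP
    obtain ⟨Q, hQI, hQ⟩ := h (homogeneousComponent_symbol_mem_symbolIdeal hPJ hP) m
    have hsub : P - Q ∈ I := ih _ (sub_mem hPJ (hIJ hQI)) fun β hβ =>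
      (HasPrincipalSymbol.homogeneousComponent_symbol hP).coeff_symbol_sub hQ hβ
    exact sub_add_cancel P Q ▸ add_mem hsub hQI

end Noetherian

lemma isNoetherianRing_diffOp (k : Type u) [Field k] [CharZero k] (n : ℕ) (A : Type u) [CommRing A]
    [Algebra k A] [Coordinates k A n] [IsNoetherianRing A] : IsNoetherianRing (DiffOp k A) := by
  have hstrict : StrictMono (symbolIdeal (k := k) (A := A) (n := n)) := fun I J hIJ =>
    lt_of_le_not_ge (symbolIdeal_mono hIJ.le) fun h => hIJ.not_ge (le_of_symbolIdeal_le hIJ.le h)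
  have := hstrict.wellFoundedGT
  exact isNoetherian_iff'.2 this

section SemilinearCombination

variable {A B : Type*} [Ring A] [Ring B] {ρ : A →+* B} {M N : Type*} [AddCommGroup M] [Module A M]
  [AddCommGroup N] [Module B N] {ι : Type*} [Fintype ι]

lemma linearCombination_comp_map (f : M →ₛₗ[ρ] N) (w : ι → M) (a : ι → A) :
    Fintype.linearCombination B (fun i => f (w i)) (fun i => ρ (a i)) =
      f (Fintype.linearCombination A w a) := by
  simp only [Fintype.linearCombination_apply, map_sum, map_smulₛₗ]

variable (ρ ι) in
/-- The map `A^ι → B^ι` induced by a ring homomorphism `A → B`. -/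
def piMapSemilinear : (ι → A) →ₛₗ[ρ] (ι → B) where
  toFun a i := ρ (a i)
  map_add' _ _ := funext fun _ => map_add ρ _ _
  map_smul' _ _ := funext fun _ => map_mul ρ _ _

end SemilinearCombination

section Completion

variable {k : Type u} [Field k] [CharZero k] {n : ℕ}

instance flat_series : Module.Flat (Poly k n) (Series k n) :=
  Module.Flat.of_linearEquiv (MvPowerSeries.toAdicCompletionAlgEquiv (Fin n) k).toLinearEquiv

variable {M M' M'' : Type u} [AddCommGroup M] [Module (D k n) M] [AddCommGroup M']
  [Module (D k n) M'] [AddCommGroup M''] [Module (D k n) M'']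
  {N : Type u} [AddCommGroup N] [Module (DHat k n) N]

namespace Completion

lemma ofFun_smul_kappa (s : Series k n) (m : M) :
    (DiffOp.ofFun s : DHat k n) • kappa k n m = tmul k n s m := by
  rw [ofFun_smul]
  exact (smul_tmul k n s 1 m).trans (by rw [mul_one])

lemma linearMap_ext {f g : Completion k n M →ₗ[DHat k n] N}
    (h : ∀ m, f (kappa k n m) = g (kappa k n m)) : f = g :=
  LinearMap.toAddMonoidHom_injective <| addHom_ext k n fun s m => by
    rw [← ofFun_smul_kappa]
    simp only [LinearMap.toAddMonoidHom_coe, map_smul, h]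

attribute [local instance] asPolyModule in
/-- The additive map underlying `Completion.lift`. -/
def liftAddHom (f : M →ₛₗ[toHat k n] N) : Completion k n M →+ N :=
  TensorProduct.liftAddHom (R := Poly k n) (M := Series k n) (N := M)
    ((AddMonoidHom.smul.comp (DiffOp.ofFun : Series k n →+* DHat k n).toAddMonoidHom).compl₂
      f.toAddMonoidHom)
    fun r s m => by
      change (DiffOp.ofFun ((r : Series k n) * s) : DHat k n) • f m =
        (DiffOp.ofFun s : DHat k n) • f ((DiffOp.ofFun r : D k n) • m)
      rw [map_smulₛₗ, toHat_ofFun, ← mul_smul, ← map_mul, mul_comm]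

lemma liftAddHom_tmul (f : M →ₛₗ[toHat k n] N) (s : Series k n) (m : M) :
    liftAddHom f (tmul k n s m) = (DiffOp.ofFun s : DHat k n) • f m := rfl

/-- The `𝒟̂`-linear map `M̂ → N`, `s ⊗ m ↦ s f(m)`, which exhibits `M̂` as the extension of scalars
of `M` along `𝒟 ⊆ 𝒟̂`. -/
def lift (f : M →ₛₗ[toHat k n] N) : Completion k n M →ₗ[DHat k n] N where
  __ := liftAddHom f
  map_smul' P z := by
    change liftAddHom f (P • z) = P • liftAddHom f z
    refine DiffOp.induction_gen (p := fun P : DHat k n => ∀ z, liftAddHom f (P • z) =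
      P • liftAddHom f z) (fun r z => ?_) (fun i z => ?_) (fun P Q hP hQ z => ?_)
      (fun P Q hP hQ z => ?_) P z
    · refine DFunLike.congr_fun (addHom_ext k n (f := (liftAddHom f).comp
        (DistribSMul.toAddMonoidHom _ (DiffOp.ofFun r : DHat k n)))
        (g := (DistribSMul.toAddMonoidHom N (DiffOp.ofFun r : DHat k n)).comp (liftAddHom f))
        fun s m => ?_) z
      change liftAddHom f ((DiffOp.ofFun r : DHat k n) • tmul k n s m) =
        (DiffOp.ofFun r : DHat k n) • (DiffOp.ofFun s : DHat k n) • f m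
      rw [ofFun_smul, smul_tmul, liftAddHom_tmul, map_mul, mul_smul]
    · refine DFunLike.congr_fun (addHom_ext k n (f := (liftAddHom f).comp
        (DistribSMul.toAddMonoidHom _ (pd k (Series k n) i)))
        (g := (DistribSMul.toAddMonoidHom N (pd k (Series k n) i)).comp (liftAddHom f))
        fun s m => ?_) z
      change liftAddHom f (pd k (Series k n) i • tmul k n s m) =
        pd k (Series k n) i • (DiffOp.ofFun s : DHat k n) • f m
      rw [pd_smul, del_tmul, map_add, liftAddHom_tmul, liftAddHom_tmul, map_smulₛₗ, toHat_pd,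
        ← mul_smul (pd k (Series k n) i), pd_mul_ofFun, add_smul, mul_smul, add_comm]
      rfl
    · rw [add_smul, map_add, hP, hQ, add_smul]
    · rw [mul_smul, hP, hQ, mul_smul]

lemma lift_kappa (f : M →ₛₗ[toHat k n] N) (m : M) : lift f (kappa k n m) = f m := by
  change (DiffOp.ofFun 1 : DHat k n) • f m = f m
  rw [map_one, one_smul]

variable (k n) in
/-- The map `M̂ → M̂'` induced by a `𝒟`-linear map `M → M'`. -/
def map (f : M →ₗ[D k n] M') : Completion k n M →ₗ[DHat k n] Completion k n M' :=
  lift ((kappa k n).comp f)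

lemma map_kappa (f : M →ₗ[D k n] M') (m : M) : map k n f (kappa k n m) = kappa k n (f m) :=
  lift_kappa _ m

attribute [local instance] asPolyModule in
variable (k n) in
/-- A `𝒟`-linear map regarded as an `R`-linear map. -/
def asPolyLinear (f : M →ₗ[D k n] M') : M →ₗ[Poly k n] M' where
  toFun := f
  map_add' := map_add f
  map_smul' r m := map_smul f (DiffOp.ofFun r : D k n) m

attribute [local instance] asPolyModule in
lemma coe_map (f : M →ₗ[D k n] M') :
    ⇑(map k n f) = LinearMap.lTensor (Series k n) (asPolyLinear k n f) :=
  DFunLike.coe_fn_eq.2 (addHom_ext k n (f := (map k n f).toAddMonoidHom)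
    (g := (LinearMap.lTensor (Series k n) (asPolyLinear k n f)).toAddMonoidHom) fun s m =>
      ofFun_smul_kappa s (f m))

attribute [local instance] asPolyModule in
lemma map_exact {f : M →ₗ[D k n] M'} {g : M' →ₗ[D k n] M''} (h : Function.Exact f g) :
    Function.Exact (map k n f) (map k n g) := by
  have h' : Function.Exact (asPolyLinear k n f) (asPolyLinear k n g) := h
  rw [coe_map, coe_map]
  exact Module.Flat.lTensor_exact (Series k n) h'

attribute [local instance] asPolyModule in
lemma map_surjective {f : M →ₗ[D k n] M'} (h : Function.Surjective f) :
    Function.Surjective (map k n f) := by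
  have h' : Function.Surjective (asPolyLinear k n f) := h
  rw [coe_map]
  exact LinearMap.lTensor_surjective (Series k n) h'

end Completion

open Classical in
variable (k n) in
/-- The isomorphism `𝒟̂^ι ≃ (𝒟^ι)^` which sends the standard basis to its image under `κ`. -/
def freeCompletionEquiv (ι : Type) [Fintype ι] :
    (ι → DHat k n) ≃ₗ[DHat k n] Completion k n (ι → D k n) :=
  LinearEquiv.ofLinearMap
    (Fintype.linearCombination (DHat k n)
      fun i => Completion.kappa k n (Pi.single i 1 : ι → D k n))
    (Completion.lift (piMapSemilinear (toHat k n) ι))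
    (Completion.linearMap_ext fun a => by
      rw [LinearMap.comp_apply, Completion.lift_kappa]
      refine (linearCombination_comp_map (Completion.kappa k n) _ a).trans ?_
      simp [Fintype.linearCombination_apply, ← Pi.single_smul, Finset.univ_sum_single])
    (LinearMap.pi_ext' fun i => LinearMap.ext_ring <| by
      simp only [LinearMap.comp_apply, LinearMap.single_apply, LinearMap.id_apply,
        Fintype.linearCombination_apply_single, one_smul, Completion.lift_kappa]
      refine funext fun l =>
        (Pi.apply_single (fun _ => toHat k n) (fun _ => map_zero _) i 1 l).trans ?_
      rw [map_one])

variable {ι ι' : Type} [Fintype ι] [Fintype ι']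

lemma freeCompletionEquiv_toHat (a : ι → D k n) :
    freeCompletionEquiv k n ι (fun i => toHat k n (a i)) = Completion.kappa k n a :=
  (LinearEquiv.eq_symm_apply _).1 (Completion.lift_kappa (piMapSemilinear (toHat k n) ι) a).symm

lemma map_comp_freeCompletionEquiv (w : ι → M) :
    Completion.map k n (Fintype.linearCombination (D k n) w) ∘ₗ
        (freeCompletionEquiv k n ι).toLinearMap =
      Fintype.linearCombination (DHat k n) (fun i => Completion.kappa k n (w i)) := by
  classical
  refine LinearMap.pi_ext' fun i => LinearMap.ext_ring ?_
  change Completion.map k n _ (Fintype.linearCombination (DHat k n) _ (Pi.single i 1)) =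
    Fintype.linearCombination (DHat k n) _ (Pi.single i 1)
  simp only [Fintype.linearCombination_apply_single, one_smul, Completion.map_kappa]

lemma freeCompletionEquiv_comp_linearCombination (v : ι → ι' → D k n) :
    (freeCompletionEquiv k n ι').toLinearMap ∘ₗ
        Fintype.linearCombination (DHat k n) (fun i l => toHat k n (v i l)) =
      Fintype.linearCombination (DHat k n) (fun i => Completion.kappa k n (v i)) := by
  classical
  refine LinearMap.pi_ext' fun i => LinearMap.ext_ring ?_
  simp only [LinearMap.comp_apply, LinearMap.single_apply, LinearEquiv.coe_coe,
    Fintype.linearCombination_apply_single, one_smul, freeCompletionEquiv_toHat]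

lemma exact_hat_augmentation {v : ι → ι' → D k n} {w : ι' → M}
    (h : Function.Exact (Fintype.linearCombination (D k n) v)
      (Fintype.linearCombination (D k n) w)) :
    Function.Exact (Fintype.linearCombination (DHat k n) (fun i l => toHat k n (v i l)))
      (Fintype.linearCombination (DHat k n) (fun i => Completion.kappa k n (w i))) := by
  refine (Function.Exact.iff_of_ladder_linearEquiv (e₁ := freeCompletionEquiv k n ι)
    (e₂ := freeCompletionEquiv k n ι') (e₃ := LinearEquiv.refl _ _) ?_ ?_).1
    (Completion.map_exact h)
  · rw [map_comp_freeCompletionEquiv, freeCompletionEquiv_comp_linearCombination]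
  · rw [map_comp_freeCompletionEquiv]
    rfl

lemma exact_hat {ι'' : Type} [Finite ι''] {v : ι → ι' → D k n}
    {w : ι' → ι'' → D k n} (h : Function.Exact (Fintype.linearCombination (D k n) v)
      (Fintype.linearCombination (D k n) w)) :
    Function.Exact (Fintype.linearCombination (DHat k n) (fun i l => toHat k n (v i l)))
      (Fintype.linearCombination (DHat k n) (fun i l => toHat k n (w i l))) := by
  have := Fintype.ofFinite ι''
  have h' := exact_hat_augmentation h
  rw [← freeCompletionEquiv_comp_linearCombination] at h'
  exact (freeCompletionEquiv k n ι'').injective.comp_exact_iff_exact.1 h'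

lemma surjective_hat_augmentation {w : ι → M}
    (h : Function.Surjective (Fintype.linearCombination (D k n) w)) :
    Function.Surjective
      (Fintype.linearCombination (DHat k n) (fun i => Completion.kappa k n (w i))) := by
  rw [← map_comp_freeCompletionEquiv, LinearMap.coe_comp]
  exact (Completion.map_surjective h).comp (LinearEquiv.surjective _)

end Completion

section FreeComplex

variable {A : Type u} [Ring A] {b : ℕ → ℕ} (v : ∀ j, Fin (b (j + 1)) → Fin (b j) → A)
  (hv : ∀ j, Function.Exact (Fintype.linearCombination A (v (j + 1)))
    (Fintype.linearCombination A (v j)))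

/-- The exact complex of free modules `A^{b_j}` whose differentials are given by matrices. -/
abbrev freeComplex : ChainComplex (ModuleCat.{u} A) ℕ :=
  exactComplex (X := fun j => Fin (b j) → A) (fun j => Fintype.linearCombination A (v j)) hv

variable (k N : Type u) [CommRing k] [AddCommGroup N] [Module k N] [Module Aᵐᵒᵖ N]
  [SMulCommClass k Aᵐᵒᵖ N]

/-- The isomorphism between the `j`-th term `N ⊗_A A^{b_j}` of the complex and `N^{b_j}`. -/
def freeTensorCoord (j : ℕ) : (tensorComplex k N (freeComplex v hv)).X j ≃ₗ[k] (Fin (b j) → N) :=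
  freeTensorEquiv k A N (Fin (b j))

lemma freeTensorCoord_d (j : ℕ) (z : (tensorComplex k N (freeComplex v hv)).X (j + 1))
    (i : Fin (b j)) :
    freeTensorCoord v hv k N j ((tensorComplex k N (freeComplex v hv)).d (j + 1) j z) i =
      ∑ i', MulOpposite.op (v j i' i) • freeTensorCoord v hv k N (j + 1) z i' := by
  have h : (tensorComplex k N (freeComplex v hv)).d (j + 1) j =
      (tensorFunctor k A N).map (ModuleCat.ofHom (Fintype.linearCombination A (v j))) :=
    congrArg (tensorFunctor k A N).map (exactComplex_d _ hv j)
  rw [h]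
  exact freeTensorEquiv_map (v j) z i

end FreeComplex

section FreeComparison

variable {k A B : Type u} [CommRing k] [Ring A] [Ring B] (ρ : A →+* B)
  {N N' : Type u} [AddCommGroup N] [Module k N] [Module Aᵐᵒᵖ N] [SMulCommClass k Aᵐᵒᵖ N]
  [AddCommGroup N'] [Module k N'] [Module Bᵐᵒᵖ N'] [SMulCommClass k Bᵐᵒᵖ N']
  {b : ℕ → ℕ} (v : ∀ j, Fin (b (j + 1)) → Fin (b j) → A)
  (hv : ∀ j, Function.Exact (Fintype.linearCombination A (v (j + 1)))
    (Fintype.linearCombination A (v j)))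
  (hv' : ∀ j, Function.Exact (Fintype.linearCombination B fun i l => ρ (v (j + 1) i l))
    (Fintype.linearCombination B fun i l => ρ (v j i l)))

/-- The chain map `A^{b_•} → B^{b_•}` induced by `ρ`. -/
def freeComplexMap : freeComplex v hv ⟶
    restrictComplex ρ (freeComplex (fun j i l => ρ (v j i l)) hv') where
  f j := semilinearHom ρ (piMapSemilinear ρ (Fin (b j)))
  comm' i j h := by
    obtain rfl : j + 1 = i := h
    have hd := exactComplex_d (X := fun j => Fin (b j) → A)
      (fun j => Fintype.linearCombination A (v j)) hv j
    have hd' : (restrictComplex ρ (freeComplex (fun j i l => ρ (v j i l)) hv')).d (j + 1) j =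
        (ModuleCat.restrictScalars ρ).map
          (ModuleCat.ofHom (Fintype.linearCombination B fun i l => ρ (v j i l))) :=
      congrArg (ModuleCat.restrictScalars ρ).map (exactComplex_d _ hv' j)
    rw [hd, hd']
    exact ModuleCat.hom_ext (LinearMap.ext fun a =>
      linearCombination_comp_map (piMapSemilinear ρ (Fin (b j))) (v j) a)

lemma freeComplexMap_comp_restrictAugmentation {M M' : Type u} [AddCommGroup M] [Module A M]
    [AddCommGroup M'] [Module B M'] (f : M →ₛₗ[ρ] M') {w : Fin (b 0) → M}
    (hw : Function.Exact (Fintype.linearCombination A (v 0)) (Fintype.linearCombination A w))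
    (hs : Function.Surjective (Fintype.linearCombination A w))
    (hw' : Function.Exact (Fintype.linearCombination B fun i l => ρ (v 0 i l))
      (Fintype.linearCombination B fun i => f (w i)))
    (hs' : Function.Surjective (Fintype.linearCombination B fun i => f (w i))) :
    (freeComplexMap ρ v hv hv').f 0 ≫ restrictAugmentation ρ
        (exactResolution (X := fun j => Fin (b j) → B) _ hv' _ hw' hs') =
      augmentation (exactResolution (X := fun j => Fin (b j) → A) _ hv _ hw hs) ≫
        semilinearHom ρ f :=
  ModuleCat.hom_ext <| LinearMap.ext fun a =>
    (augmentation_exactResolution (X := fun j => Fin (b j) → B) _ hv' _ hw' hs'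
      (fun i => ρ (a i))).trans <| (linearCombination_comp_map f w a).trans <|
    congrArg f (augmentation_exactResolution (X := fun j => Fin (b j) → A) _ hv _ hw hs a).symm

variable (g : N →ₗ[k] N')
  (hg : ∀ (a : A) (x : N), g (MulOpposite.op a • x) = MulOpposite.op (ρ a) • g x)

lemma freeTensorCoord_tensorChainMap (j : ℕ) (z : (tensorComplex k N (freeComplex v hv)).X j)
    (i : Fin (b j)) :
    freeTensorCoord (fun j i l => ρ (v j i l)) hv' k N' j
      ((tensorChainMap ρ g hg (freeComplexMap ρ v hv hv')).f j z) i =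
      g (freeTensorCoord v hv k N j z i) := by
  let F : BalancedTensor k A N (Fin (b j) → A) →ₗ[k] N' :=
    LinearMap.proj i ∘ₗ (freeTensorCoord (fun j i l => ρ (v j i l)) hv' k N' j).toLinearMap ∘ₗ
      ((tensorChainMap ρ g hg (freeComplexMap ρ v hv hv')).f j).hom
  let G : BalancedTensor k A N (Fin (b j) → A) →ₗ[k] N' :=
    g ∘ₗ LinearMap.proj i ∘ₗ (freeTensorCoord v hv k N j).toLinearMap
  have : F = G := BalancedTensor.hom_ext fun x a => (hg (a i) x).symm
  exact LinearMap.congr_fun this z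

variable (p : ∀ j, Fin (b j) → (N' →ₗ[k] N))

/-- The linear map `N' ⊗_B B^{b_j} → N ⊗_A A^{b_j}` given by the maps `p j i` on coordinates. -/
def coordMap (j : ℕ) : (tensorComplex k N' (freeComplex (fun j i l => ρ (v j i l)) hv')).X j →ₗ[k]
    (tensorComplex k N (freeComplex v hv)).X j :=
  (freeTensorCoord v hv k N j).symm.toLinearMap ∘ₗ
    LinearMap.pi (fun i => p j i ∘ₗ LinearMap.proj i) ∘ₗ
    (freeTensorCoord (fun j i l => ρ (v j i l)) hv' k N' j).toLinearMap

lemma freeTensorCoord_coordMap (j : ℕ)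
    (z : (tensorComplex k N' (freeComplex (fun j i l => ρ (v j i l)) hv')).X j) (i : Fin (b j)) :
    freeTensorCoord v hv k N j (coordMap ρ v hv hv' p j z) i =
      p j i (freeTensorCoord (fun j i l => ρ (v j i l)) hv' k N' j z i) :=
  congrFun (LinearEquiv.apply_symm_apply _ _) i

variable {p} (hp : ∀ j i i' s, p j i (MulOpposite.op (ρ (v j i' i)) • s) =
  MulOpposite.op (v j i' i) • p (j + 1) i' s)

include hp in
lemma d_coordMap (j : ℕ)
    (z : (tensorComplex k N' (freeComplex (fun j i l => ρ (v j i l)) hv')).X (j + 1)) :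
    (tensorComplex k N (freeComplex v hv)).d (j + 1) j (coordMap ρ v hv hv' p (j + 1) z) =
      coordMap ρ v hv hv' p j
        ((tensorComplex k N' (freeComplex (fun j i l => ρ (v j i l)) hv')).d (j + 1) j z) :=
  (freeTensorCoord v hv k N j).injective <| funext fun i => by
    rw [freeTensorCoord_d, freeTensorCoord_coordMap, freeTensorCoord_d, map_sum]
    simp only [hp, freeTensorCoord_coordMap]

/-- The chain map `N' ⊗_B B^{b_•} → N ⊗_A A^{b_•}` given by the maps `p j i` on coordinates. -/
def coordChainMap : tensorComplex k N' (freeComplex (fun j i l => ρ (v j i l)) hv') ⟶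
    tensorComplex k N (freeComplex v hv) where
  f j := ModuleCat.ofHom (coordMap ρ v hv hv' p j)
  comm' i j h := by
    obtain rfl : j + 1 = i := h
    exact ModuleCat.hom_ext (LinearMap.ext (d_coordMap ρ v hv hv' hp j))

variable (deg : ∀ j, Fin (b j) → ℤ) {q : ℤ → (N' →ₗ[k] N)}
  (hq : ∀ l j i i' s, q (l - deg j i) (MulOpposite.op (ρ (v j i' i)) • s) =
    MulOpposite.op (v j i' i) • q (l - deg (j + 1) i') s)

lemma isGradedCompletion_tensorChainMap (h : IsGradedCompletion g q) (j : ℕ) :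
    IsGradedCompletion ((tensorChainMap ρ g hg (freeComplexMap ρ v hv hv')).f j).hom
      (fun l => ((coordChainMap ρ v hv hv' (hq l)).f j).hom) :=
  .of_coordinates (fun i => h.comp_equiv (Equiv.subRight (deg j i)))
    (freeTensorCoord v hv k N j) (freeTensorCoord (fun j i l => ρ (v j i l)) hv' k N' j)
    (freeTensorCoord_tensorChainMap ρ v hv hv' g hg j)
    fun l => freeTensorCoord_coordMap ρ v hv hv' (fun j i => q (l - deg j i)) j

end FreeComparison

section Iota

variable {k : Type u} [Field k] {n : ℕ}

lemma isGradedCompletion_polyToSeries :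
    IsGradedCompletion (polyToSeries k n) (hcompT k n) where
  exists_sum_eq x :=
    ⟨(MvPolynomial.support (show Poly k n from x)).image fun d => (d.degree : ℤ),
      sum_hcomp (show Poly k n from x) fun _ hd => Finset.mem_image_of_mem _ hd⟩
  proj_self l y := (hcomp_hcomp l l y).trans (if_pos rfl)
  proj_of_ne l m y hlm := (hcomp_hcomp l m y).trans (if_neg hlm)
  exists_proj_eq x := exists_hcomp_eq fun l => polyToSeries k n (x l)
  eq_zero_of_proj _ hy := hcomp_ext hy

variable [CharZero k] {M : Type u} [AddCommGroup M] [Module (D k n) M] [Module.Finite (D k n) M]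
  {ℳ : ℤ → AddSubgroup M} (hℳ : IsGradedDModule k n ℳ)

include hℳ

theorem exists_resolutions_isGradedCompletion :
    ∃ (P : ProjectiveResolution (ModuleCat.of (D k n) M))
      (Q : ProjectiveResolution (ModuleCat.of (DHat k n) (Completion k n M)))
      (φ : P.complex ⟶ restrictComplex (toHat k n) Q.complex)
      (π : ℤ → (tensorComplex k (Transpose (Series k n)) Q.complex ⟶
        tensorComplex k (Transpose (Poly k n)) P.complex)),
      φ.f 0 ≫ restrictAugmentation (toHat k n) Q =
        augmentation P ≫ semilinearHom (toHat k n) (Completion.kappa k n) ∧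
      ∀ j, IsGradedCompletion ((tensorChainMap (toHat k n) (polyToSeries k n)
          (fun P => polyToSeries_smul k n (MulOpposite.op P)) φ).f j).hom
        (fun l => ((π l).f j).hom) := by
  have := hℳ.gradedSMul
  have := isNoetherianRing_diffOp k n (Poly k n)
  obtain ⟨b, deg, v, w, hdeg, hv, hw, hs⟩ :=
    exists_graded_resolution (isInternal_gradeD (k := k) (n := n)) hℳ.isInternal
  have hv' (j : ℕ) := exact_hat (hv j)
  have hw' := exact_hat_augmentation hw
  have hs' := surjective_hat_augmentation hs
  have hq (l j i i') (s : Transpose (Series k n)) :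
      hcompT k n (l - deg j i) (MulOpposite.op (toHat k n (v j i' i)) • s) =
        MulOpposite.op (v j i' i) • hcompT k n (l - deg (j + 1) i') s := by
    rw [← hcompT_op_smul (hdeg j i' i), sub_add_sub_cancel]
  exact ⟨exactResolution (X := fun j => Fin (b j) → D k n) _ hv _ hw hs,
    exactResolution (X := fun j => Fin (b j) → DHat k n) _ hv' _ hw' hs',
    freeComplexMap (toHat k n) v hv hv', fun l => coordChainMap (toHat k n) v hv hv' (hq l),
    freeComplexMap_comp_restrictAugmentation _ v hv hv' _ hw hs hw' hs',
    isGradedCompletion_tensorChainMap _ v hv hv' _ _ deg hq isGradedCompletion_polyToSeries⟩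

theorem iota_injective (j : ℕ) : Function.Injective (iota k n M j) := by
  obtain ⟨P, Q, φ, π, hφ, hπ⟩ := exists_resolutions_isGradedCompletion hℳ
  exact (torMap_injective_iff _ _ _ hφ j).2 (IsGradedCompletion.homologyMap_injective hπ j)

theorem iota_surjective (j : ℕ)
    [FiniteDimensional k (Tor k (D k n) (Transpose (Poly k n)) j M)] :
    Function.Surjective (iota k n M j) := by
  obtain ⟨P, Q, φ, π, hφ, hπ⟩ := exists_resolutions_isGradedCompletion hℳ
  have : FiniteDimensional k
      ((tensorComplex k (Transpose (Poly k n)) P.complex).homology j) :=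
    (leftDerivedIsoHomology (tensorFunctor k _ _) P j).toLinearEquiv.finiteDimensional
  exact (torMap_surjective_iff _ _ _ hφ j).2 (IsGradedCompletion.homologyMap_surjective hπ j)

end Iota

end

end DMod

theorem mainTheorem4 (k : Type u) [Field k] [CharZero k] (n : ℕ)
    (M : Type u) [AddCommGroup M] [Module (DMod.D k n) M] [Module.Finite (DMod.D k n) M]
    (ℳ : ℤ → AddSubgroup M) (hℳ : DMod.IsGradedDModule k n ℳ) :
    (∀ j : ℕ, Function.Injective (DMod.iota k n M j)) ∧
      ∀ j : ℕ, FiniteDimensional k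
          (DMod.Tor k (DMod.D k n) (DMod.Transpose (DMod.Poly k n)) j M) →
        Function.Bijective (DMod.iota k n M j) :=
  ⟨DMod.iota_injective hℳ,
    fun j _ => ⟨DMod.iota_injective hℳ j, DMod.iota_surjective hℳ j⟩⟩
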